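/- **Setting.** Write $[r]=\{1,\dots,r\}$. An $[[n,k]]$ *self-dual CSS code* is the stabilizer code on $n$ qubits whose stabilizer group is $\{X^{g}Z^{h} : g,h\in C\}$, where $C\subseteq\mathbb F_2^n$ is a self-orthogonal subspace of dimension $(n-k)/2$. A *symplectic basis* of it is a family of pairs $(\bar X_j,\bar Z_j)_{j\in[k]}$ of Hermitian Pauli operators that commute with all stabilizers, with $\bar X_j\bar Z_j=-\bar Z_j\bar X_j$ and all other pairs commuting, and that together with the stabilizers and $iI$ generate the centralizer of the stabilizer group in the Pauli group. It determines, up to a global phase, an isometry $E$ from $(\mathbb C^2)^{\otimes k}$ onto the code space with $EX_j=\bar X_jE$ and $EZ_j=\bar Z_jE$. A physical operator $V$ *implements* a logical operator $U$ if $VE=c\,EU$ for some $|c|=1$. The basis is *compatible* if $H^{\otimes n}$ implements $H^{\otimes k}$ and if for every $a\in\{1,-1\}^k$ there is $b\in\{1,-1\}^n$ such that $\bigotimes_{i} S^{b_i}$ implements $\bigotimes_{j} S^{a_j}$. For $c\in[L]$ let $\mathcal Q_c$ be an $[[n_c,k_c]]$ self-dual CSS code with $k_c\ge 1$, equipped with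 a compatible symplectic basis. In the concatenated code $\mathcal Q_L\circ\cdots\circ\mathcal Q_1$ the logical qubits at level $l\in\{0,\dots,L\}$ are labelled by $[k_1]\times\cdots\times[k_l]\times[n_{l+1}]\times\cdots\times[n_L]$; for all fixed $j_1,\dots,j_{l-1},i_{l+1},\dots,i_L$, the code $\mathcal Q_l$ encodes the qubits $(j_1,\dots,j_{l-1},j,i_{l+1},\dots,i_L)$, $j\in[k_l]$, at level $l$ into the qubits $(j_1,\dots,j_{l-1},i,i_{l+1},\dots,i_L)$, $i\in[n_l]$, at level $l-1$. For $t\le l$ let $E_{t,l}$ be the resulting encoding of the states of the level-$l$ qubits into states of the level-$t$ qubits (with $E_{l,l}=I$). A gate $U$ on the level-$l$ qubits of one block of the concatenated code is *transversal at level $t$* if there are single-qubit unitaries $G_q$, one for each level-$t$ qubit $q$, with $(\bigotimes_q G_q)E_{t,l}=E_{t,l}U$. A gate $V$ on the level-$l$ qubits of two blocks is *transversal at level $t$* if there are two-qubit unitaries $F_q$, with $F_q$ acting on the level-$t$ qubits labelled $q$ of the first and of the second block, such that $(\bigotimes_q F_q)(E_{t,l}\otimes E_{t,l})=(E_{t,l}\otimes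 E_{t,l})V$. **Theorem.** Let $0\le m<l\le L$, let $j_1\in[k_1],\dots,j_m\in[k_m]$, $i_{l+1}\in[n_{l+1}],\dots,i_L\in[n_L]$, and put $$A=\{j_1\}\times\cdots\times\{j_m\}\times[k_{m+1}]\times\cdots\times[k_l]\times\{i_{l+1}\}\times\cdots\times\{i_L\}.$$ Then the following gates at level $l$ are transversal at each of the levels $m,m+1,\dots,l$: 1. the gate on one block that applies $H$ to each level-$l$ qubit in $A$ and the identity to the others; 2. for every $a\in\{1,-1\}^{A}$, the gate on one block that applies $S^{a_q}$ to each level-$l$ qubit $q\in A$ and the identity to the others; 3. the gate on two blocks that, for each $q\in A$, applies a CNOT gate with the level-$l$ qubit $q$ of the first block as control and the level-$l$ qubit $q$ of the second block as target, and the identity to the others. -/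

import Mathlib

open Matrix

namespace Multilevel

noncomputable section

/-! ### Qubits, product gates and Pauli operators

A register of qubits labelled by `ι` has the state space `(ι → Fin 2) → ℂ`; an operator is a
matrix in the computational basis. -/

/-- Operators on a register of qubits labelled by `ι`. -/
abbrev Op (ι : Type) : Type := Matrix (ι → Fin 2) (ι → Fin 2) ℂ

/-- `⨂ i, G i`: the single-qubit operator `G i` acts on qubit `i`. -/
def tensor {ι : Type} [Fintype ι] (G : ι → Matrix (Fin 2) (Fin 2) ℂ) : Op ι :=
  Matrix.of fun x y => ∏ i, G i (x i) (y i)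

/-- Operators on two registers, both labelled by `ι`. -/
abbrev Op₂ (ι : Type) : Type :=
  Matrix ((ι → Fin 2) × (ι → Fin 2)) ((ι → Fin 2) × (ι → Fin 2)) ℂ

/-- `⨂ i, F i`: the two-qubit operator `F i` acts on qubit `i` of the first register and qubit `i`
of the second register. -/
def tensor₂ {ι : Type} [Fintype ι] (F : ι → Matrix (Fin 2 × Fin 2) (Fin 2 × Fin 2) ℂ) : Op₂ ι :=
  Matrix.of fun x y => ∏ i, F i (x.1 i, x.2 i) (y.1 i, y.2 i)

def sigmaX : Matrix (Fin 2) (Fin 2) ℂ := !![0, 1; 1, 0]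

def sigmaZ : Matrix (Fin 2) (Fin 2) ℂ := !![1, 0; 0, -1]

/-- The Hadamard gate. -/
def hadamard : Matrix (Fin 2) (Fin 2) ℂ := ((Real.sqrt 2 : ℝ) : ℂ)⁻¹ • !![1, 1; 1, -1]

/-- The phase gate `S`. -/
def phaseS : Matrix (Fin 2) (Fin 2) ℂ := !![1, 0; 0, Complex.I]

/-- `S ^ a` for `a ∈ {1, -1}`, where `S ^ (-1)` is the adjoint of `S`. -/
def phasePow (a : ℤˣ) : Matrix (Fin 2) (Fin 2) ℂ := if a = 1 then phaseS else phaseSᴴ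

/-- The CNOT gate `|c, t⟩ ↦ |c, c + t⟩`; the first qubit is the control. -/
def cnot : Matrix (Fin 2 × Fin 2) (Fin 2 × Fin 2) ℂ :=
  Matrix.of fun x y => if x = (y.1, y.1 + y.2) then 1 else 0

section Pauli

variable {ι : Type} [Fintype ι]

/-- The `X`-type Pauli operator acting as `X` on the qubits `i` with `x i = 1`. -/
def pauliX (x : ι → ZMod 2) : Op ι := tensor fun i => if x i = 1 then sigmaX else 1

/-- The `Z`-type Pauli operator acting as `Z` on the qubits `i` with `z i = 1`. -/
def pauliZ (z : ι → ZMod 2) : Op ι := tensor fun i => if z i = 1 then sigmaZ else 1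

/-- Membership in the Pauli group (with phases `1, i, -1, -i`). -/
def IsPauli [DecidableEq ι] (P : Op ι) : Prop :=
  ∃ (c : ℕ) (x z : ι → ZMod 2), P = Complex.I ^ c • (pauliX x * pauliZ z)

end Pauli

/-! ### Self-dual CSS codes -/

/-- A self-dual CSS code with `n` physical and `k` logical qubits. `checks` is the row space of the
common check matrix of the `X`-type and the `Z`-type stabilizer generators, that is, the dual of a
classical code that contains its dual. It has dimension `(n - k) / 2`. -/
structure SelfDualCSS (n k : ℕ) where
  checks : Submodule (ZMod 2) (Fin n → ZMod 2)
  orthogonal : ∀ g ∈ checks, ∀ h ∈ checks, g ⬝ᵥ h = 0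
  finrank_checks : 2 * Module.finrank (ZMod 2) checks + k = n

section SingleCode

variable {n k : ℕ}

/-- The stabilizer group. -/
def SelfDualCSS.stabilizers (Q : SelfDualCSS n k) : Set (Op (Fin n)) :=
  {s | ∃ g ∈ Q.checks, ∃ h ∈ Q.checks, s = pauliX g * pauliZ h}

/-- The code space: the simultaneous `+1` eigenspace of the stabilizers. -/
def SelfDualCSS.codeSpace (Q : SelfDualCSS n k) : Submodule ℂ ((Fin n → Fin 2) → ℂ) where
  carrier := {ψ | ∀ s ∈ Q.stabilizers, s *ᵥ ψ = ψ}
  add_mem' {a b} ha hb s hs := by rw [Matrix.mulVec_add, ha s hs, hb s hs]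
  zero_mem' s _ := Matrix.mulVec_zero s
  smul_mem' c a ha s hs := by rw [Matrix.mulVec_smul, ha s hs]

/-- A symplectic basis: `k` hyperbolic pairs `(X j, Z j)` of (Hermitian) Pauli operators, not
necessarily of pure `X`- or `Z`-type, which together with the stabilizers and `i` generate the
centralizer of the stabilizer group in the Pauli group. -/
structure SymplecticBasis (Q : SelfDualCSS n k) where
  X : Fin k → Op (Fin n)
  Z : Fin k → Op (Fin n)
  isPauli_X : ∀ j, IsPauli (X j)
  isPauli_Z : ∀ j, IsPauli (Z j)
  isHermitian_X : ∀ j, (X j).IsHermitian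
  isHermitian_Z : ∀ j, (Z j).IsHermitian
  commute_X_stabilizer : ∀ j, ∀ s ∈ Q.stabilizers, Commute (X j) s
  commute_Z_stabilizer : ∀ j, ∀ s ∈ Q.stabilizers, Commute (Z j) s
  anticommute : ∀ j, X j * Z j = -(Z j * X j)
  commute_XZ : ∀ j j', j ≠ j' → Commute (X j) (Z j')
  commute_XX : ∀ j j', Commute (X j) (X j')
  commute_ZZ : ∀ j j', Commute (Z j) (Z j')
  generate : ∀ P, IsPauli P → (∀ s ∈ Q.stabilizers, Commute P s) →
    P ∈ Submonoid.closure
      (Q.stabilizers ∪ {Complex.I • (1 : Op (Fin n))} ∪ Set.range X ∪ Set.range Z)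

/-- `E` is an encoding map for the symplectic basis `B`: an isometry from the states of `k` logical
qubits onto the code space which turns the Pauli operators of the `j`-th qubit into the logical
Pauli operators `B.X j` and `B.Z j`. The column of `E` at `a` is the logical basis state labelled
by `a`. Such a map exists (`exists_encoder`) and is unique up to a global phase. -/
structure IsEncoder {Q : SelfDualCSS n k} (B : SymplecticBasis Q)
    (E : Matrix (Fin n → Fin 2) (Fin k → Fin 2) ℂ) : Prop where
  isometry : Eᴴ * E = 1
  range_eq : LinearMap.range E.mulVecLin = Q.codeSpace
  map_X : ∀ j, E * pauliX (Pi.single j 1) = B.X j * E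
  map_Z : ∀ j, E * pauliZ (Pi.single j 1) = B.Z j * E

/-! #### Existence of the encoding map -/

theorem tensor_mul {ι : Type} [Fintype ι] [DecidableEq ι] (G H : ι → Matrix (Fin 2) (Fin 2) ℂ) :
    tensor G * tensor H = tensor fun i => G i * H i := by
  ext x y
  simp only [tensor, Matrix.mul_apply, Matrix.of_apply, ← Finset.prod_mul_distrib]
  rw [Finset.prod_univ_sum, Fintype.piFinset_univ]

theorem tensor_one {ι : Type} [Fintype ι] [DecidableEq ι] :
    tensor (fun _ : ι => (1 : Matrix (Fin 2) (Fin 2) ℂ)) = 1 := by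
  ext x y
  simp only [tensor, Matrix.of_apply, Matrix.one_apply, funext_iff]
  by_cases h : ∀ i, x i = y i
  · simp [h]
  · rw [if_neg h]
    obtain ⟨i, hi⟩ := not_forall.mp h
    exact Finset.prod_eq_zero (Finset.mem_univ i) (if_neg hi)

theorem trace_tensor {ι : Type} [Fintype ι] [DecidableEq ι] (G : ι → Matrix (Fin 2) (Fin 2) ℂ) :
    (tensor G).trace = ∏ i, (G i).trace := by
  simp only [tensor, Matrix.trace, Matrix.diag, Matrix.of_apply]
  rw [Finset.prod_univ_sum, Fintype.piFinset_univ]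

theorem conjTranspose_tensor {ι : Type} [Fintype ι] (G : ι → Matrix (Fin 2) (Fin 2) ℂ) :
    (tensor G)ᴴ = tensor fun i => (G i)ᴴ := by
  ext x y
  simp [tensor, Matrix.conjTranspose_apply]

theorem zmod_two_cases (a : ZMod 2) : a = 0 ∨ a = 1 := by
  revert a; decide

theorem sigmaX_mul_self : sigmaX * sigmaX = 1 := by
  ext i j; fin_cases i <;> fin_cases j <;> simp [sigmaX]

theorem sigmaZ_mul_self : sigmaZ * sigmaZ = 1 := by
  ext i j; fin_cases i <;> fin_cases j <;> simp [sigmaZ]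

theorem sigmaZ_mul_sigmaX : sigmaZ * sigmaX = (-1 : ℂ) • (sigmaX * sigmaZ) := by
  ext i j; fin_cases i <;> fin_cases j <;> simp [sigmaX, sigmaZ]

theorem tensor_smul {ι : Type} [Fintype ι] (r : ι → ℂ) (G : ι → Matrix (Fin 2) (Fin 2) ℂ) :
    tensor (fun i => r i • G i) = (∏ i, r i) • tensor G := by
  ext x y
  simp [tensor, Finset.prod_mul_distrib]

theorem conjTranspose_pauliX {ι : Type} [Fintype ι] (x : ι → ZMod 2) :
    (pauliX x)ᴴ = pauliX x := by
  rw [pauliX, conjTranspose_tensor]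
  congr 1; funext i
  split_ifs
  · ext a b; fin_cases a <;> fin_cases b <;> simp [sigmaX]
  · simp

theorem conjTranspose_pauliZ {ι : Type} [Fintype ι] (x : ι → ZMod 2) :
    (pauliZ x)ᴴ = pauliZ x := by
  rw [pauliZ, conjTranspose_tensor]
  congr 1; funext i
  split_ifs
  · ext a b; fin_cases a <;> fin_cases b <;> simp [sigmaZ]
  · simp

section PauliLemmas

variable {ι : Type} [Fintype ι] [DecidableEq ι]

theorem pauliX_zero : pauliX (0 : ι → ZMod 2) = 1 := by
  simp [pauliX, tensor_one]

theorem pauliZ_zero : pauliZ (0 : ι → ZMod 2) = 1 := by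
  simp [pauliZ, tensor_one]

theorem pauliX_add (x y : ι → ZMod 2) : pauliX (x + y) = pauliX x * pauliX y := by
  rw [pauliX, pauliX, pauliX, tensor_mul]
  congr 1; funext i
  rcases zmod_two_cases (x i) with h | h <;> rcases zmod_two_cases (y i) with h2 | h2 <;>
    simp [h, h2, sigmaX_mul_self, CharTwo.add_self_eq_zero]

theorem pauliZ_add (x y : ι → ZMod 2) : pauliZ (x + y) = pauliZ x * pauliZ y := by
  rw [pauliZ, pauliZ, pauliZ, tensor_mul]
  congr 1; funext i
  rcases zmod_two_cases (x i) with h | h <;> rcases zmod_two_cases (y i) with h2 | h2 <;>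
    simp [h, h2, sigmaZ_mul_self, CharTwo.add_self_eq_zero]

/-- The sign `(-1) ^ a`. -/
def sgn (a : ZMod 2) : ℂ := if a = 1 then -1 else 1

theorem sgn_add (a b : ZMod 2) : sgn (a + b) = sgn a * sgn b := by
  rcases zmod_two_cases a with h | h <;> rcases zmod_two_cases b with h2 | h2 <;>
    simp [h, h2, sgn, CharTwo.add_self_eq_zero]

theorem sgn_sum (f : ι → ZMod 2) : sgn (∑ i, f i) = ∏ i, sgn (f i) := by
  have : ∀ s : Finset ι, sgn (∑ i ∈ s, f i) = ∏ i ∈ s, sgn (f i) := by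
    intro s
    induction s using Finset.induction_on with
    | empty => simp [sgn]
    | insert a s ha ih => rw [Finset.sum_insert ha, Finset.prod_insert ha, sgn_add, ih]
  exact this _

theorem pauliZ_mul_pauliX (z x : ι → ZMod 2) :
    pauliZ z * pauliX x = sgn (z ⬝ᵥ x) • (pauliX x * pauliZ z) := by
  rw [pauliX, pauliZ, tensor_mul, tensor_mul, dotProduct, sgn_sum, ← tensor_smul]
  congr 1; funext i
  rcases zmod_two_cases (x i) with h | h <;> rcases zmod_two_cases (z i) with h2 | h2 <;>
    simp [h, h2, sigmaZ_mul_sigmaX, sgn]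

theorem pauliX_mul_self (x : ι → ZMod 2) : pauliX x * pauliX x = 1 := by
  rw [← pauliX_add, ← pauliX_zero]; congr 1; funext i; exact CharTwo.add_self_eq_zero _

theorem pauliZ_mul_self (x : ι → ZMod 2) : pauliZ x * pauliZ x = 1 := by
  rw [← pauliZ_add, ← pauliZ_zero]; congr 1; funext i; exact CharTwo.add_self_eq_zero _

theorem IsPauli.mul_self {P : Op ι} (h : IsPauli P) (hP : P.IsHermitian) : P * P = 1 := by
  nth_rewrite 1 [← hP.eq]
  obtain ⟨c, x, z, rfl⟩ := h
  rw [conjTranspose_smul, conjTranspose_mul, conjTranspose_pauliX, conjTranspose_pauliZ,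
    smul_mul_smul_comm, mul_assoc, ← mul_assoc (pauliX x), pauliX_mul_self, one_mul,
    pauliZ_mul_self]
  have : star (Complex.I ^ c) * Complex.I ^ c = 1 := by
    rw [star_pow, ← mul_pow]; simp
  rw [this, one_smul]

theorem trace_pauli (x z : ι → ZMod 2) :
    (pauliX x * pauliZ z).trace = if x = 0 ∧ z = 0 then 2 ^ Fintype.card ι else 0 := by
  split_ifs with h
  · rw [h.1, h.2, pauliX_zero, pauliZ_zero, mul_one]
    simp [Matrix.trace_one]
  · rw [pauliX, pauliZ, tensor_mul, trace_tensor]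
    have : ∃ i, x i ≠ 0 ∨ z i ≠ 0 := by
      by_contra hc
      push Not at hc
      exact h ⟨funext fun i => (hc i).1, funext fun i => (hc i).2⟩
    obtain ⟨i, hi⟩ := this
    apply Finset.prod_eq_zero (Finset.mem_univ i)
    rcases zmod_two_cases (x i) with h | h <;> rcases zmod_two_cases (z i) with h2 | h2 <;>
      simp_all [sigmaX, sigmaZ, Matrix.trace_fin_two]

end PauliLemmas

open Classical in
/-- The code space has dimension `2 ^ k`. -/
theorem finrank_codeSpace (Q : SelfDualCSS n k) : Module.finrank ℂ Q.codeSpace = 2 ^ k := by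
  set N : ℂ := (Fintype.card Q.checks : ℂ) with hN
  have hN0 : N ≠ 0 := by rw [hN]; exact_mod_cast Fintype.card_ne_zero
  set T : Op (Fin n) := ∑ p : Q.checks × Q.checks, pauliX (p.1 : Fin n → ZMod 2) * pauliZ (p.2 : Fin n → ZMod 2) with hT
  have habs : ∀ s ∈ Q.stabilizers, s * T = T := by
    rintro s ⟨g, hg, h, hh, rfl⟩
    rw [hT, Finset.mul_sum]
    refine Fintype.sum_equiv (Equiv.addLeft ((⟨g, hg⟩, ⟨h, hh⟩) : Q.checks × Q.checks)) _ _ ?_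
    rintro ⟨⟨a, ha⟩, ⟨b, hb⟩⟩
    simp only [Equiv.coe_addLeft, Prod.mk_add_mk, AddMemClass.mk_add_mk]
    rw [pauliX_add, pauliZ_add, mul_assoc, ← mul_assoc (pauliZ h), pauliZ_mul_pauliX,
      Q.orthogonal h hh a ha]
    simp [sgn, mul_assoc]
  set P : Op (Fin n) := (N ^ 2)⁻¹ • T with hP
  have hproj : LinearMap.IsProj Q.codeSpace (Matrix.toLin' P) := by
    constructor
    · intro v s hs
      rw [Matrix.toLin'_apply, Matrix.mulVec_mulVec, hP, Matrix.mul_smul, habs s hs]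
    · intro v hv
      have : T *ᵥ v = (N ^ 2) • v := by
        rw [hT, Matrix.sum_mulVec, Finset.sum_congr rfl (g := fun _ => v)]
        · rw [Finset.sum_const, Finset.card_univ, Fintype.card_prod, ← Nat.cast_smul_eq_nsmul ℂ, hN]
          push_cast; rw [pow_two]
        · rintro ⟨⟨a, ha⟩, ⟨b, hb⟩⟩ -
          exact hv _ ⟨a, ha, b, hb, rfl⟩
      rw [Matrix.toLin'_apply, hP, Matrix.smul_mulVec, this, smul_smul, inv_mul_cancel₀ (by positivity), one_smul]
  have htr := hproj.trace
  rw [Matrix.trace_toLin'_eq, hP, Matrix.trace_smul, hT, Matrix.trace_sum] at htr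
  simp only [trace_pauli] at htr
  rw [Finset.sum_eq_single (0 : Q.checks × Q.checks)] at htr
  · have hcard : Fintype.card Q.checks = 2 ^ Module.finrank (ZMod 2) Q.checks := by
      rw [Module.card_eq_pow_finrank (K := ZMod 2), ZMod.card]
    have h2 : (2 : ℂ) ^ n = N ^ 2 * 2 ^ k := by
      rw [hN, hcard]; push_cast
      rw [← pow_mul, ← pow_add, mul_comm _ 2, Q.finrank_checks]
    simp only [Prod.fst_zero, Prod.snd_zero, ZeroMemClass.coe_zero, and_self, if_true,
      Fintype.card_fin, h2, smul_eq_mul] at htr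
    rw [← mul_assoc, inv_mul_cancel₀ (pow_ne_zero 2 hN0), one_mul] at htr
    exact_mod_cast htr.symm
  · rintro ⟨⟨a, ha⟩, ⟨b, hb⟩⟩ - h
    apply if_neg
    rintro ⟨h1, h2⟩
    apply h
    simp only at h1 h2
    subst h1; subst h2; rfl
  · simp

/-- There is a nonzero encoded state fixed by all the `Z j`. -/
theorem exists_logical_zero {Q : SelfDualCSS n k} (B : SymplecticBasis Q) :
    ∃ ψ ∈ Q.codeSpace, ψ ≠ 0 ∧ ∀ j, B.Z j *ᵥ ψ = ψ := by
  have hX := fun j => (B.isPauli_X j).mul_self (B.isHermitian_X j)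
  have hZ := fun j => (B.isPauli_Z j).mul_self (B.isHermitian_Z j)
  have key : ∀ T : Finset (Fin k), ∃ ψ ∈ Q.codeSpace, ψ ≠ 0 ∧ ∀ j ∈ T, B.Z j *ᵥ ψ = ψ := by
    intro T
    induction T using Finset.induction_on with
    | empty =>
      have : Q.codeSpace ≠ ⊥ := by
        intro h
        have h1 := finrank_codeSpace Q
        rw [h, finrank_bot] at h1
        exact (pow_ne_zero k two_ne_zero) h1.symm
      obtain ⟨ψ, h1, h2⟩ := Submodule.exists_mem_ne_zero_of_ne_bot this
      exact ⟨ψ, h1, h2, by simp⟩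
    | insert j T hj ih =>
      obtain ⟨ψ, h1, h2, h3⟩ := ih
      by_cases h : ψ + B.Z j *ᵥ ψ = 0
      · have h4 : B.Z j *ᵥ ψ = -ψ := by rw [eq_neg_iff_add_eq_zero, add_comm]; exact h
        refine ⟨B.X j *ᵥ ψ, ?_, ?_, ?_⟩
        · intro s hs
          rw [Matrix.mulVec_mulVec, ← (B.commute_X_stabilizer j s hs).eq, ← Matrix.mulVec_mulVec,
            h1 s hs]
        · intro h0
          apply h2
          rw [← Matrix.one_mulVec ψ, ← hX j, ← Matrix.mulVec_mulVec, h0, Matrix.mulVec_zero]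
        · intro i hi
          rcases Finset.mem_insert.mp hi with rfl | hi
          · rw [Matrix.mulVec_mulVec, ← neg_eq_iff_eq_neg.mpr (B.anticommute i), Matrix.neg_mulVec,
              ← Matrix.mulVec_mulVec, h4, Matrix.mulVec_neg, neg_neg]
          · have hne : j ≠ i := by rintro rfl; exact hj hi
            rw [Matrix.mulVec_mulVec, ← (B.commute_XZ j i hne).eq, ← Matrix.mulVec_mulVec, h3 i hi]
      · refine ⟨ψ + B.Z j *ᵥ ψ, ?_, h, ?_⟩
        · intro s hs
          rw [Matrix.mulVec_add, Matrix.mulVec_mulVec, ← (B.commute_Z_stabilizer j s hs).eq,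
            ← Matrix.mulVec_mulVec, h1 s hs]
        · intro i hi
          rcases Finset.mem_insert.mp hi with rfl | hi
          · rw [Matrix.mulVec_add, Matrix.mulVec_mulVec, hZ, Matrix.one_mulVec, add_comm]
          · rw [Matrix.mulVec_add, Matrix.mulVec_mulVec, (B.commute_ZZ i j).eq,
              ← Matrix.mulVec_mulVec, h3 i hi]
  obtain ⟨ψ, h1, h2, h3⟩ := key Finset.univ
  exact ⟨ψ, h1, h2, fun j => h3 j (Finset.mem_univ j)⟩

/-- Basis labels of a register as binary vectors. -/
def bits {ι : Type} : (ι → Fin 2) ≃ (ι → ZMod 2) := Equiv.refl _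

theorem pauliX_apply {ι : Type} [Fintype ι] [DecidableEq ι] (x : ι → ZMod 2) (y b : ι → Fin 2) :
    pauliX x y b = if bits y = bits b + x then 1 else 0 := by
  have hs : ∀ i, (if x i = 1 then sigmaX else 1) (y i) (b i) =
      if bits y i = bits b i + x i then (1 : ℂ) else 0 := by
    intro i
    have key : ∀ (u : ZMod 2) (v w : Fin 2), ((show ZMod 2 from v) = (show ZMod 2 from w) + u) ↔
        ((u = 0 ∧ v = w) ∨ (u = 1 ∧ v ≠ w)) := by decide
    have key2 : bits y i = bits b i + x i ↔ ((x i = 0 ∧ y i = b i) ∨ (x i = 1 ∧ y i ≠ b i)) :=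
      key (x i) (y i) (b i)
    rw [if_congr key2 rfl rfl]
    generalize x i = u
    generalize y i = v
    generalize b i = w
    rcases zmod_two_cases u with rfl | rfl <;> fin_cases v <;> fin_cases w <;> simp [sigmaX]
  simp only [pauliX, tensor, Matrix.of_apply, hs]
  by_cases h : bits y = bits b + x
  · rw [if_pos h]
    exact Finset.prod_eq_one fun i _ => if_pos (congrFun h i)
  · rw [if_neg h]
    obtain ⟨i, hi⟩ := Function.ne_iff.mp h
    exact Finset.prod_eq_zero (Finset.mem_univ i) (if_neg hi)

theorem pauliZ_single_apply {ι : Type} [Fintype ι] [DecidableEq ι] (j : ι) :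
    pauliZ (Pi.single j 1 : ι → ZMod 2) = Matrix.diagonal fun y => sgn (bits y j) := by
  have : pauliZ (Pi.single j 1 : ι → ZMod 2) = tensor fun i => Matrix.diagonal fun v : Fin 2 =>
      if i = j then (if v = 1 then -1 else 1) else 1 := by
    rw [pauliZ]; congr 1; funext i
    by_cases h : i = j
    · subst h
      ext a b; fin_cases a <;> fin_cases b <;> simp [sigmaZ]
    · simp [h]
  rw [this]
  ext y b
  simp only [tensor, Matrix.of_apply, Matrix.diagonal_apply]
  by_cases h : y = b
  · subst h; simp; rfl
  · rw [if_neg h]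
    obtain ⟨i, hi⟩ := Function.ne_iff.mp h
    exact Finset.prod_eq_zero (Finset.mem_univ i) (if_neg hi)

theorem exists_logical_X {Q : SelfDualCSS n k} (B : SymplecticBasis Q) :
    ∃ f : (Fin k → ZMod 2) → Op (Fin n), f 0 = 1 ∧ (∀ a b, f (a + b) = f a * f b) ∧
      ∀ j, f (Pi.single j 1) = B.X j := by
  have hX := fun j => (B.isPauli_X j).mul_self (B.isHermitian_X j)
  let ϕ : Fin k → (Multiplicative (ZMod 2) →* Op (Fin n)) := fun j =>
    { toFun := fun a => if a.toAdd = 1 then B.X j else 1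
      map_one' := by simp
      map_mul' := by
        intro a b
        rcases zmod_two_cases a.toAdd with h | h <;> rcases zmod_two_cases b.toAdd with h2 | h2 <;>
          simp [h, h2, hX, CharTwo.add_self_eq_zero] }
  have hc : Pairwise fun i j => ∀ (x y : Multiplicative (ZMod 2)), Commute (ϕ i x) (ϕ j y) := by
    intro i j _ x y
    simp only [ϕ, MonoidHom.coe_mk, OneHom.coe_mk]
    split_ifs <;> simp [B.commute_XX]
  refine ⟨fun a => MonoidHom.noncommPiCoprod ϕ hc fun j => Multiplicative.ofAdd (a j), ?_, ?_, ?_⟩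
  · exact map_one (MonoidHom.noncommPiCoprod ϕ hc)
  · intro a b
    rw [← map_mul]; rfl
  · intro j
    have : (fun i => Multiplicative.ofAdd ((Pi.single j 1 : Fin k → ZMod 2) i)) =
        Pi.mulSingle j (Multiplicative.ofAdd (1 : ZMod 2)) := by
      funext i
      by_cases h : i = j
      · subst h; simp
      · simp [h]
    beta_reduce
    rw [this, MonoidHom.noncommPiCoprod_mulSingle]
    simp [ϕ]

open scoped ComplexOrder in
theorem exists_encoder {Q : SelfDualCSS n k} (B : SymplecticBasis Q) : ∃ E, IsEncoder B E := by
  have hZ := fun j => (B.isPauli_Z j).mul_self (B.isHermitian_Z j)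
  obtain ⟨ψ₀, hψ₀, hne, hψZ₀⟩ := exists_logical_zero B
  obtain ⟨ψ, hψ, hψZ, hnorm⟩ : ∃ ψ ∈ Q.codeSpace, (∀ j, B.Z j *ᵥ ψ = ψ) ∧ star ψ ⬝ᵥ ψ = 1 := by
    have hpos : 0 < star ψ₀ ⬝ᵥ ψ₀ := dotProduct_star_self_pos_iff.mpr hne
    obtain ⟨r, hr, hr2⟩ : ∃ r : ℝ, 0 < r ∧ star ψ₀ ⬝ᵥ ψ₀ = r := by
      have := Complex.pos_iff.mp hpos
      exact ⟨_, this.1, Complex.ext rfl this.2.symm⟩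
    refine ⟨((Real.sqrt r : ℝ) : ℂ)⁻¹ • ψ₀, Q.codeSpace.smul_mem _ hψ₀, ?_, ?_⟩
    · intro j; rw [Matrix.mulVec_smul, hψZ₀]
    · rw [star_smul, smul_dotProduct, dotProduct_smul, hr2, ← Complex.ofReal_inv]
      simp only [Complex.star_def, Complex.conj_ofReal, smul_eq_mul]
      norm_cast
      have := Real.mul_self_sqrt hr.le
      have h0 : Real.sqrt r ≠ 0 := (Real.sqrt_pos.mpr hr).ne'
      field_simp
      rw [pow_two, this]
  obtain ⟨f, f0, fadd, fX⟩ := exists_logical_X B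
  have ind : ∀ p : (Fin k → ZMod 2) → Prop, p 0 → (∀ a b, p a → p b → p (a + b)) →
      (∀ j, p (Pi.single j 1)) → ∀ a, p a := by
    intro p p0 padd ps a
    rw [← Finset.univ_sum_single a]
    refine Finset.sum_induction _ p padd p0 fun i _ => ?_
    rcases zmod_two_cases (a i) with h | h
    · rw [h, Pi.single_zero]; exact p0
    · rw [h]; exact ps i
  have fherm : ∀ a, (f a)ᴴ = f a := by
    refine ind _ (by rw [f0]; simp) ?_ ?_
    · intro a b ha hb
      rw [fadd, conjTranspose_mul, ha, hb, ← fadd, ← fadd, add_comm]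
    · intro j; rw [fX]; exact B.isHermitian_X j
  have fstab : ∀ a, ∀ s ∈ Q.stabilizers, Commute (f a) s := by
    refine ind _ (by rw [f0]; simp) ?_ ?_
    · intro a b ha hb s hs
      rw [fadd]; exact (ha s hs).mul_left (hb s hs)
    · intro j; rw [fX]; exact B.commute_X_stabilizer j
  have fZ : ∀ j a, B.Z j * f a = sgn (a j) • (f a * B.Z j) := by
    intro j
    refine ind _ (by rw [f0]; simp [sgn]) ?_ ?_
    · intro a b ha hb
      rw [fadd, ← mul_assoc, ha, Matrix.smul_mul, mul_assoc, hb, Matrix.mul_smul, smul_smul,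
        Pi.add_apply, sgn_add, mul_assoc]
    · intro i
      rw [fX]
      by_cases h : i = j
      · subst h; simp [sgn, B.anticommute]
      · rw [← (B.commute_XZ i j h).eq]; simp [sgn, Ne.symm h]
  have fself : ∀ a, f a * f a = 1 := by
    intro a
    rw [← fadd, ← f0]; congr 1; funext i; exact CharTwo.add_self_eq_zero _
  have forth : ∀ a : Fin k → ZMod 2, a ≠ 0 → star ψ ⬝ᵥ (f a *ᵥ ψ) = 0 := by
    intro a ha
    obtain ⟨j, hj⟩ := Function.ne_iff.mp ha
    have hj1 : a j = 1 := (zmod_two_cases (a j)).resolve_left hj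
    have h1 : star ψ ⬝ᵥ (f a *ᵥ ψ) = star ψ ⬝ᵥ (B.Z j *ᵥ (f a *ᵥ ψ)) := by
      have : star ψ = star ψ ᵥ* B.Z j := by
        conv_lhs => rw [← hψZ j, Matrix.star_mulVec, (B.isHermitian_Z j).eq]
      conv_lhs => rw [this]
      rw [Matrix.dotProduct_mulVec (star ψ) (B.Z j)]
    rw [Matrix.mulVec_mulVec, fZ, hj1, Matrix.smul_mulVec, ← Matrix.mulVec_mulVec, hψZ] at h1
    simp only [sgn, if_true, neg_smul, one_smul, dotProduct_neg] at h1
    exact self_eq_neg.mp h1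
  let E : Matrix (Fin n → Fin 2) (Fin k → Fin 2) ℂ := Matrix.of fun x a => (f (bits a) *ᵥ ψ) x
  have hiso : Eᴴ * E = 1 := by
    ext a b
    have h1 : (Eᴴ * E) a b = star (f (bits a) *ᵥ ψ) ⬝ᵥ (f (bits b) *ᵥ ψ) := rfl
    have h2 : star (f (bits a) *ᵥ ψ) ⬝ᵥ (f (bits b) *ᵥ ψ) = star ψ ⬝ᵥ (f (bits a + bits b) *ᵥ ψ) := by
      rw [Matrix.star_mulVec, fherm, ← Matrix.dotProduct_mulVec, Matrix.mulVec_mulVec, fadd]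
    rw [h1, h2, Matrix.one_apply]
    split_ifs with h
    · subst h
      rw [fadd, fself, Matrix.one_mulVec, hnorm]
    · apply forth
      intro h0
      apply h
      apply bits.injective
      funext i
      exact CharTwo.add_eq_zero.mp (congrFun h0 i)
  refine ⟨E, hiso, ?_, ?_, ?_⟩
  · apply Submodule.eq_of_le_of_finrank_eq
    · rintro _ ⟨φ, rfl⟩ s hs
      have : s * E = E := by
        ext x a
        have h1 : (s * E) x a = (s *ᵥ (f (bits a) *ᵥ ψ)) x := rfl
        rw [h1, Matrix.mulVec_mulVec, ← (fstab (bits a) s hs).eq, ← Matrix.mulVec_mulVec, hψ s hs]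
        rfl
      rw [Matrix.mulVecLin_apply, Matrix.mulVec_mulVec, this]
    · rw [finrank_codeSpace, LinearMap.finrank_range_of_inj]
      · simp
      · intro u v huv
        have h1 := congrArg (fun w => Eᴴ *ᵥ w) huv
        simpa [Matrix.mulVec_mulVec, hiso] using h1
  · intro j
    ext x a
    have h1 : (B.X j * E) x a = (B.X j *ᵥ (f (bits a) *ᵥ ψ)) x := rfl
    rw [h1, Matrix.mulVec_mulVec, ← fX, ← fadd, Matrix.mul_apply]
    rw [Finset.sum_eq_single (bits.symm (bits a + Pi.single j 1))]
    · rw [pauliX_apply, if_pos (by simp), mul_one, add_comm]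
      simp [E]
    · intro b _ hb
      rw [pauliX_apply, if_neg, mul_zero]
      intro h
      exact hb (by rw [← h]; simp)
    · simp
  · intro j
    ext x a
    have h1 : (B.Z j * E) x a = (B.Z j *ᵥ (f (bits a) *ᵥ ψ)) x := rfl
    rw [h1, Matrix.mulVec_mulVec, fZ, Matrix.smul_mulVec, ← Matrix.mulVec_mulVec, hψZ,
      pauliZ_single_apply, Matrix.mul_diagonal, Pi.smul_apply, smul_eq_mul, mul_comm]
    rfl

/-- The encoding map of a symplectic basis (unique up to a global phase, which plays no role
below). -/
def SymplecticBasis.encoder {Q : SelfDualCSS n k} (B : SymplecticBasis Q) :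
    Matrix (Fin n → Fin 2) (Fin k → Fin 2) ℂ :=
  Classical.choose (exists_encoder B)

theorem SymplecticBasis.isEncoder {Q : SelfDualCSS n k} (B : SymplecticBasis Q) :
    IsEncoder B B.encoder :=
  Classical.choose_spec (exists_encoder B)

/-- The physical operator `V` on one code block implements the logical operator `U`, up to a global
phase. -/
def SymplecticBasis.Implements {Q : SelfDualCSS n k} (B : SymplecticBasis Q)
    (V : Op (Fin n)) (U : Op (Fin k)) : Prop :=
  ∃ c : ℂ, ‖c‖ = 1 ∧ V * B.encoder = c • (B.encoder * U)

/-- Compatibility with multilevel transversal Clifford operations: the logical Hadamard gate on all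
logical qubits is the transversal physical Hadamard gate, and each choice of logical `S` or `S†` on
all the logical qubits is given by some choice of physical `S` or `S†` on all the physical
qubits. -/
structure SymplecticBasis.IsCompatible {Q : SelfDualCSS n k} (B : SymplecticBasis Q) : Prop where
  hadamard : B.Implements (tensor fun _ => hadamard) (tensor fun _ => hadamard)
  phase : ∀ a : Fin k → ℤˣ, ∃ b : Fin n → ℤˣ,
    B.Implements (tensor fun i => phasePow (b i)) (tensor fun j => phasePow (a j))

end SingleCode

/-! ### Concatenated codes

The `L` codes are numbered by `c : Fin L`, starting from the innermost one; code `c` encodes the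
logical qubits at level `c` into those at level `c + 1`. -/

section Concatenation

variable {L : ℕ}

/-- The range of the `c`-th index of a logical qubit at level `l`. -/
abbrev size (n k : Fin L → ℕ) (l : ℕ) (c : Fin L) : ℕ := if c.val < l then k c else n c

/-- Labels of the logical qubits at level `l`: the elements of
`[k_1] × ⋯ × [k_l] × [n_{l+1}] × ⋯ × [n_L]`. Level `0` consists of the physical qubits. -/
abbrev Idx (n k : Fin L → ℕ) (l : ℕ) : Type := ∀ c : Fin L, Fin (size n k l c)

/-- Labels of the blocks of code `c`: all indices other than the `c`-th one. -/
abbrev Block (n k : Fin L → ℕ) (c : Fin L) : Type :=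
  ∀ c' : {c' : Fin L // c' ≠ c}, Fin (size n k c.val c')

variable {n k : Fin L → ℕ}

/-- The label of the `i`-th of the `n c` qubits at level `c` which belong to the block `b`. -/
def Block.inner {c : Fin L} (b : Block n k c) (i : Fin (n c)) : Idx n k c.val :=
  fun c' => if h : c' = c then Fin.cast (by subst h; simp [size]) i else b ⟨c', h⟩

/-- The label of the `j`-th of the `k c` qubits at level `c + 1` which belong to the block `b`. -/
def Block.outer {c : Fin L} (b : Block n k c) (j : Fin (k c)) : Idx n k (c.val + 1) :=
  fun c' => if h : c' = c then Fin.cast (by subst h; simp [size]) j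
    else Fin.cast (by
      have h1 : c'.val ≠ c.val := fun e => h (Fin.ext e)
      have h2 : c'.val < c.val + 1 ↔ c'.val < c.val := by omega
      simp only [size, h2]) (b ⟨c', h⟩)

variable {Q : ∀ c, SelfDualCSS (n c) (k c)}

/-- The encoding of code `c`, applied to each of its blocks: it maps the states of the logical
qubits at level `c + 1` to states of those at level `c`. -/
def stepEncoder (B : ∀ c, SymplecticBasis (Q c)) (c : Fin L) :
    Matrix (Idx n k c.val → Fin 2) (Idx n k (c.val + 1) → Fin 2) ℂ :=
  Matrix.of fun x y =>
    ∏ b : Block n k c, (B c).encoder (fun i => x (b.inner i)) (fun j => y (b.outer j))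

/-- The encoding of the logical qubits at level `l` into those at level `m`, for `m ≤ l ≤ L`: the
composition of the encodings of the codes `m, …, l - 1`. -/
def levelEncoder (B : ∀ c, SymplecticBasis (Q c)) {m l : ℕ} (h : m ≤ l) :
    Matrix (Idx n k m → Fin 2) (Idx n k l → Fin 2) ℂ :=
  Nat.leRecOn (C := fun l => Matrix (Idx n k m → Fin 2) (Idx n k l → Fin 2) ℂ) h
    (fun {l} E => if hl : l < L then E * stepEncoder B ⟨l, hl⟩ else 0) 1

/-- The gate `U` on the logical qubits at level `l` of one block of the concatenated code is
transversal at level `m`: on the encoded states it is a product of single-qubit gates on the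
logical qubits at level `m`. -/
def IsTransversalAt (B : ∀ c, SymplecticBasis (Q c)) {m l : ℕ} (h : m ≤ l)
    (U : Op (Idx n k l)) : Prop :=
  ∃ G : Idx n k m → Matrix (Fin 2) (Fin 2) ℂ,
    (∀ q, G q ∈ Matrix.unitaryGroup (Fin 2) ℂ) ∧
    tensor G * levelEncoder B h = levelEncoder B h * U

/-- The gate `V` on the logical qubits at level `l` of two blocks of the concatenated code is
transversal at level `m`: on the encoded states it is a product of two-qubit gates, each acting on
the logical qubits at level `m` with the same label in the two blocks. -/
def IsTransversalAt₂ (B : ∀ c, SymplecticBasis (Q c)) {m l : ℕ} (h : m ≤ l)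
    (V : Op₂ (Idx n k l)) : Prop :=
  ∃ F : Idx n k m → Matrix (Fin 2 × Fin 2) (Fin 2 × Fin 2) ℂ,
    (∀ q, F q ∈ Matrix.unitaryGroup (Fin 2 × Fin 2) ℂ) ∧
    tensor₂ F * kroneckerMap (· * ·) (levelEncoder B h) (levelEncoder B h) =
      kroneckerMap (· * ·) (levelEncoder B h) (levelEncoder B h) * V

variable {l : ℕ}

open Classical in
/-- The Hadamard-type transversal gate at level `l`: Hadamard gates on the qubits in the product of
the sets `A c`. -/
def gateH (A : ∀ c, Set (Fin (size n k l c))) : Op (Idx n k l) :=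
  tensor fun q => if ∀ c, q c ∈ A c then hadamard else 1

open Classical in
/-- The phase-type transversal gate at level `l`: `S` or its adjoint, as specified by `a`, on each
qubit in the product of the sets `A c` (the other values of `a` are not used). -/
def gateS (A : ∀ c, Set (Fin (size n k l c))) (a : Idx n k l → ℤˣ) : Op (Idx n k l) :=
  tensor fun q => if ∀ c, q c ∈ A c then phasePow (a q) else 1

open Classical in
/-- The CNOT-type transversal gate at level `l`: CNOT gates from the first to the second block on
the pairs of qubits with the same label in the product of the sets `A c`. -/
def gateCNOT (A : ∀ c, Set (Fin (size n k l c))) : Op₂ (Idx n k l) :=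
  tensor₂ fun q => if ∀ c, q c ∈ A c then cnot else 1

/-- The sets `{j_1}, …, {j_m}, [k_{m+1}], …, [k_l], {i_{l+1}}, …, {i_L}`, where the fixed indices
are those of `q`. -/
def indexSets (m : ℕ) (q : Idx n k l) (c : Fin L) : Set (Fin (size n k l c)) :=
  if m ≤ c.val ∧ c.val < l then Set.univ else {q c}

end Concatenation

end

end Multilevel

open scoped Kronecker

namespace Multilevel

/-! The argument pushes a gate down one code at a time. The set `A` is saturated: membership does
not depend on the indices of the codes between levels `t` and `l`. Hence every block of the
outermost of these codes has either all or none of its logical qubits in `A`. On a full block the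
compatible basis provides a product gate on the physical qubits; on the others the identity is used.
The qubits of the full blocks form a saturated set one level lower, so induction on `l` applies
(`isTransversalAt_tensor`). Each block may contribute a global phase, which is absorbed into the
gate on a single qubit.

For `H` and `S` the gates needed in each block are given by compatibility. For CNOT they must be
derived (`exists_cnot`). Write X(u), Z(u) for `pauliX u`, `pauliZ u`, C for the checks and E for the
encoder. Logical phase gates commute with the logical Z operators, while physical phase gates turn
X(x)Z(z) into a multiple of X(x)Z(x+z). So if X(x) is the X-part of a logical Z operator, then Z(x)
is a scalar on the code space and x lies in C. Thus the j-th logical Z acts as ±Z(u_j) for some u_j,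
and by the Hadamard symmetry the j-th logical X acts as ±X(u_j) with the same sign (-1)^(e_j). The
generation property of the basis then shows that the dual of C is C plus the span of the u_j.

The logical state E|a⟩ is supported on vectors x in the dual of C with u_j · x = e_j + a_j. The
transversal CNOT, for such an x in the first block, applies X(x) to the second block, and this is
the logical X(e + a) up to the sign (-1)^(e · (e + a)). Hence the result is the logical CNOT
preceded by Z(e) on the first block and X(e) on the second, up to a global sign. This Pauli operator
is itself transversal at every lower level (`isTransversalAt_pauli`), so it can be cancelled. -/

theorem zmod_two_pi_induction {ι : Type} [Fintype ι] [DecidableEq ι] {p : (ι → ZMod 2) → Prop}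
    (zero : p 0) (add : ∀ a b, p a → p b → p (a + b)) (single : ∀ j, p (Pi.single j 1)) (a) :
    p a := by
  rw [← Finset.univ_sum_single a]
  refine Finset.sum_induction _ p add zero fun i _ => ?_
  rcases zmod_two_cases (a i) with h | h
  · rw [h, Pi.single_zero]; exact zero
  · rw [h]; exact single i

theorem pi_zmod_two_add_self {ι : Type} (x : ι → ZMod 2) : x + x = 0 :=
  funext fun _ => CharTwo.add_self_eq_zero _

theorem sgn_mul_self (a : ZMod 2) : sgn a * sgn a = 1 := by
  rw [sgn]; split_ifs <;> simp

theorem sgn_injective : Function.Injective sgn := by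
  intro a b h
  rcases zmod_two_cases a with rfl | rfl <;> rcases zmod_two_cases b with rfl | rfl
  · rfl
  · norm_num [sgn] at h
  · norm_num [sgn] at h
  · rfl

theorem sgn_ne_zero (a : ZMod 2) : sgn a ≠ 0 := by
  rw [sgn]; split_ifs <;> simp

theorem norm_sgn (a : ZMod 2) : ‖sgn a‖ = 1 := by
  rw [sgn]; split_ifs <;> simp

theorem exists_sgn_eq {c : ℂ} (h : c * c = 1) : ∃ a, c = sgn a := by
  rcases mul_self_eq_one_iff.mp h with rfl | rfl
  · exact ⟨0, by simp [sgn]⟩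
  · exact ⟨1, by simp [sgn]⟩

/-! ### Pauli operators and their conjugation by Hadamard and phase gates -/

section Pauli

variable {ι : Type} [Fintype ι] [DecidableEq ι]

theorem pauli_mul_pauli (x z x' z' : ι → ZMod 2) :
    pauliX x * pauliZ z * (pauliX x' * pauliZ z') =
      sgn (z ⬝ᵥ x') • (pauliX (x + x') * pauliZ (z + z')) := by
  rw [pauliX_add, pauliZ_add, mul_assoc, ← mul_assoc (pauliZ z), pauliZ_mul_pauliX]
  simp [mul_assoc]

theorem IsPauli.one : IsPauli (1 : Op ι) := ⟨0, 0, 0, by simp [pauliX_zero, pauliZ_zero]⟩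

theorem IsPauli.mul {P P' : Op ι} (h : IsPauli P) (h' : IsPauli P') : IsPauli (P * P') := by
  obtain ⟨c, x, z, rfl⟩ := h
  obtain ⟨c', x', z', rfl⟩ := h'
  have : ∃ d : ℕ, sgn (z ⬝ᵥ x') = Complex.I ^ d := by
    rw [sgn]; split_ifs
    · exact ⟨2, by simp⟩
    · exact ⟨0, by simp⟩
  obtain ⟨d, hd⟩ := this
  refine ⟨c + c' + d, x + x', z + z', ?_⟩
  rw [smul_mul_smul_comm, pauli_mul_pauli, smul_smul, hd, pow_add, pow_add]

theorem isPauli_pauliX (x : ι → ZMod 2) : IsPauli (pauliX x) :=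
  ⟨0, x, 0, by simp [pauliZ_zero]⟩

theorem pauliX_mul_pauliZ_ne_zero (x z : ι → ZMod 2) : pauliX x * pauliZ z ≠ 0 := by
  intro h
  have h1 : pauliX x * (pauliX x * pauliZ z) * pauliZ z = 1 := by
    rw [← mul_assoc, pauliX_mul_self, one_mul, pauliZ_mul_self]
  rw [h] at h1
  simp at h1

/-- The `X`-part of a Pauli operator is determined by the operator. -/
theorem pauliX_part_unique {c : ℂ} {x x' z z' : ι → ZMod 2}
    (h : pauliX x * pauliZ z = c • (pauliX x' * pauliZ z')) : x = x' := by
  by_contra hne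
  have h1 := congrArg (fun M => (pauliX x' * M * pauliZ z').trace) h
  -- A nontrivial Pauli operator has trace zero, so for distinct X-parts the left side vanishes,
  -- while the right side is `c` times the trace of the identity. This forces `c = 0`, although
  -- Pauli operators are nonzero.
  simp only [Matrix.mul_smul, Matrix.smul_mul, trace_smul] at h1
  have h2 : pauliX x' * (pauliX x' * pauliZ z') * pauliZ z' = 1 := by
    rw [← mul_assoc, pauliX_mul_self, one_mul, pauliZ_mul_self]
  have h3 : pauliX x' * (pauliX x * pauliZ z) * pauliZ z' = pauliX (x' + x) * pauliZ (z + z') := by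
    rw [pauliX_add, pauliZ_add]; simp only [mul_assoc]
  rw [h2, h3, trace_pauli, if_neg] at h1
  · simp only [trace_one, smul_eq_mul, zero_eq_mul] at h1
    rcases h1 with rfl | h1
    · rw [zero_smul] at h
      exact pauliX_mul_pauliZ_ne_zero _ _ h
    · simp at h1
  · rintro ⟨h4, -⟩
    exact hne (funext fun i => (CharTwo.add_eq_zero.mp (congrFun h4 i)).symm)

theorem pauliZ_eq_diagonal (z : ι → ZMod 2) :
    pauliZ z = Matrix.diagonal fun y => sgn (z ⬝ᵥ bits y) := by
  revert z
  refine zmod_two_pi_induction ?_ ?_ ?_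
  · simp [pauliZ_zero, sgn]
  · intro a b ha hb
    rw [pauliZ_add, ha, hb, diagonal_mul_diagonal]
    congr 1; funext y
    rw [add_dotProduct, sgn_add]
  · intro j
    rw [pauliZ_single_apply]
    congr 1; funext y
    rw [single_one_dotProduct]

theorem pauliX_mul_apply {κ : Type*} (x : ι → ZMod 2) (M : Matrix (ι → Fin 2) κ ℂ)
    (y : ι → Fin 2) (a : κ) : (pauliX x * M) y a = M (bits.symm (bits y + x)) a := by
  rw [Matrix.mul_apply, Finset.sum_eq_single (bits.symm (bits y + x))]
  · rw [pauliX_apply, if_pos, one_mul]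
    rw [Equiv.apply_symm_apply, add_assoc, pi_zmod_two_add_self x, add_zero]
  · intro b _ hb
    rw [pauliX_apply, if_neg, zero_mul]
    intro h
    apply hb
    rw [h, add_assoc, pi_zmod_two_add_self x, add_zero, Equiv.symm_apply_apply]
  · simp

theorem mul_pauliX_apply {κ : Type*} (x : ι → ZMod 2) (M : Matrix κ (ι → Fin 2) ℂ)
    (a : κ) (y : ι → Fin 2) : (M * pauliX x) a y = M a (bits.symm (bits y + x)) := by
  rw [Matrix.mul_apply, Finset.sum_eq_single (bits.symm (bits y + x))]
  · rw [pauliX_apply, if_pos, mul_one]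
    rw [Equiv.apply_symm_apply]
  · intro b _ hb
    rw [pauliX_apply, if_neg, mul_zero]
    intro h
    apply hb
    rw [← h, Equiv.symm_apply_apply]
  · simp

theorem sqrt_two_inv_mul_self :
    ((Real.sqrt 2 : ℝ) : ℂ)⁻¹ * ((Real.sqrt 2 : ℝ) : ℂ)⁻¹ = 2⁻¹ := by
  rw [← mul_inv, ← Complex.ofReal_mul, Real.mul_self_sqrt (by norm_num)]; norm_num

theorem hadamard_mul_self : hadamard * hadamard = 1 := by
  rw [hadamard, smul_mul_smul_comm, sqrt_two_inv_mul_self]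
  ext i j; fin_cases i <;> fin_cases j <;> norm_num [Matrix.mul_apply]

theorem hadamard_mul_sigmaZ : hadamard * sigmaZ = sigmaX * hadamard := by
  ext i j; fin_cases i <;> fin_cases j <;> simp [hadamard, sigmaX, sigmaZ, Matrix.mul_apply]

theorem tensor_hadamard_mul_pauliZ (z : ι → ZMod 2) :
    tensor (fun _ => hadamard) * pauliZ z = pauliX z * tensor fun _ => hadamard := by
  rw [pauliX, pauliZ, tensor_mul, tensor_mul]
  congr 1; funext i
  split_ifs
  · exact hadamard_mul_sigmaZ
  · simp

theorem conjTranspose_phaseS : phaseSᴴ = !![1, 0; 0, -Complex.I] := by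
  ext i j; fin_cases i <;> fin_cases j <;> simp [phaseS]

theorem phasePow_mul_conjTranspose (a : ℤˣ) : phasePow a * (phasePow a)ᴴ = 1 := by
  rw [phasePow]
  split_ifs <;> ext i j <;> fin_cases i <;> fin_cases j <;>
    simp [phaseS, Matrix.mul_apply]

/-- Both S and its adjoint conjugate X to a multiple of XZ; the sign `a` affects only the scalar,
`i` or `-i`. Only `r ≠ 0` matters later, so the pattern of signs on the physical qubits is
irrelevant there. -/
theorem phasePow_mul_sigmaX (a : ℤˣ) : ∃ r : ℂ, r ≠ 0 ∧
    phasePow a * sigmaX = r • (sigmaX * sigmaZ * phasePow a) := by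
  rw [phasePow]
  split_ifs
  · refine ⟨Complex.I, by simp, ?_⟩
    ext i j; fin_cases i <;> fin_cases j <;> simp [phaseS, sigmaX, sigmaZ, Matrix.mul_apply]
  · refine ⟨-Complex.I, by simp, ?_⟩
    rw [conjTranspose_phaseS]
    ext i j; fin_cases i <;> fin_cases j <;> simp [sigmaX, sigmaZ, Matrix.mul_apply]

theorem phasePow_mul_sigmaZ (a : ℤˣ) : phasePow a * sigmaZ = sigmaZ * phasePow a := by
  rw [phasePow]
  split_ifs <;> ext i j <;> fin_cases i <;> fin_cases j <;>
    simp [phaseS, sigmaZ, Matrix.mul_apply]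

theorem tensor_phasePow_mul_pauliZ (b : ι → ℤˣ) (z : ι → ZMod 2) :
    tensor (fun i => phasePow (b i)) * pauliZ z = pauliZ z * tensor fun i => phasePow (b i) := by
  rw [pauliZ, tensor_mul, tensor_mul]
  congr 1; funext i
  split_ifs
  · exact phasePow_mul_sigmaZ _
  · simp

theorem tensor_phasePow_mul_pauliX (b : ι → ℤˣ) (x : ι → ZMod 2) : ∃ r : ℂ, r ≠ 0 ∧
    tensor (fun i => phasePow (b i)) * pauliX x =
      r • (pauliX x * pauliZ x * tensor fun i => phasePow (b i)) := by
  choose r hr h using fun i => phasePow_mul_sigmaX (b i)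
  refine ⟨∏ i, if x i = 1 then r i else 1, ?_, ?_⟩
  · refine Finset.prod_ne_zero_iff.mpr fun i _ => ?_
    split_ifs
    · exact hr i
    · exact one_ne_zero
  · rw [pauliX, pauliZ, tensor_mul, tensor_mul, tensor_mul, ← tensor_smul]
    congr 1; funext i
    split_ifs
    · exact h i
    · simp

theorem tensor_phasePow_mul_conjTranspose (b : ι → ℤˣ) :
    tensor (fun i => phasePow (b i)) * tensor (fun i => (phasePow (b i))ᴴ) = 1 := by
  simp only [tensor_mul, phasePow_mul_conjTranspose, tensor_one]

end Pauli

/-! ### Logical Pauli operators of one self-dual CSS code -/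

section SingleCode

variable {n k : ℕ} {Q : SelfDualCSS n k}

/-- The double orthogonal of a subspace is the subspace itself: a vector outside C is separated from
C by a linear functional, and every functional is a dot product. -/
theorem SelfDualCSS.mem_checks_of_dual (Q : SelfDualCSS n k) {x : Fin n → ZMod 2}
    (h : ∀ y, (∀ g ∈ Q.checks, g ⬝ᵥ y = 0) → x ⬝ᵥ y = 0) : x ∈ Q.checks := by
  by_contra hx
  obtain ⟨f, hf, hker⟩ := Submodule.exists_le_ker_of_notMem hx
  have hdot : ∀ v, f v = v ⬝ᵥ fun i => f (Pi.single i 1) := by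
    intro v
    rw [LinearMap.pi_apply_eq_sum_univ f v]
    simp [dotProduct]
    congr 1; funext i; congr 2; funext j; simp [Pi.single_apply, eq_comm]
  refine hf ?_
  rw [hdot]
  refine h _ fun g hg => ?_
  rw [← hdot]
  exact hker hg

theorem SelfDualCSS.pauliX_mem_stabilizers (Q : SelfDualCSS n k) {g : Fin n → ZMod 2}
    (hg : g ∈ Q.checks) : pauliX g ∈ Q.stabilizers :=
  ⟨g, hg, 0, Q.checks.zero_mem, by rw [pauliZ_zero, mul_one]⟩

theorem SelfDualCSS.pauliZ_mem_stabilizers (Q : SelfDualCSS n k) {h : Fin n → ZMod 2}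
    (hh : h ∈ Q.checks) : pauliZ h ∈ Q.stabilizers :=
  ⟨0, Q.checks.zero_mem, h, hh, by rw [pauliX_zero, one_mul]⟩

theorem SelfDualCSS.commute_pauliX (Q : SelfDualCSS n k) {y : Fin n → ZMod 2}
    (hy : ∀ g ∈ Q.checks, g ⬝ᵥ y = 0) : ∀ s ∈ Q.stabilizers, Commute (pauliX y) s := by
  rintro s ⟨g, hg, h, hh, rfl⟩
  refine Commute.mul_right ?_ ?_
  · rw [commute_iff_eq, ← pauliX_add, ← pauliX_add, add_comm]
  · rw [commute_iff_eq, pauliZ_mul_pauliX, hy h hh]; simp [sgn]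

theorem SelfDualCSS.commute_pauliZ (Q : SelfDualCSS n k) {y : Fin n → ZMod 2}
    (hy : ∀ g ∈ Q.checks, g ⬝ᵥ y = 0) : ∀ s ∈ Q.stabilizers, Commute (pauliZ y) s := by
  rintro s ⟨g, hg, h, hh, rfl⟩
  refine Commute.mul_right ?_ ?_
  · rw [commute_iff_eq, pauliZ_mul_pauliX, dotProduct_comm, hy g hg]; simp [sgn]
  · rw [commute_iff_eq, ← pauliZ_add, ← pauliZ_add, add_comm]

variable (B : SymplecticBasis Q)

theorem SymplecticBasis.stabilizer_mul_encoder {s : Op (Fin n)} (hs : s ∈ Q.stabilizers) :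
    s * B.encoder = B.encoder := by
  refine Matrix.ext_of_mulVec_single fun a => ?_
  have h : B.encoder *ᵥ Pi.single a 1 ∈ Q.codeSpace := by
    rw [← B.isEncoder.range_eq]; exact ⟨_, rfl⟩
  rw [← Matrix.mulVec_mulVec]
  exact h s hs

theorem SymplecticBasis.smul_encoder_injective {a b : ℂ} (h : a • B.encoder = b • B.encoder) :
    a = b := by
  have h1 := congrArg (fun M : Matrix (Fin n → Fin 2) (Fin k → Fin 2) ℂ => (B.encoderᴴ * M) 0 0) h
  simpa [B.isEncoder.isometry] using h1

/-- Operators that commute with the stabilizers preserve the code space. -/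
theorem SymplecticBasis.exists_mul_encoder {P : Op (Fin n)}
    (hP : ∀ s ∈ Q.stabilizers, Commute P s) : ∃ M : Op (Fin k), P * B.encoder = B.encoder * M := by
  -- The columns of P E stay in the code space, which is the range of E, and E Eᴴ is the identity
  -- there.
  refine ⟨B.encoderᴴ * (P * B.encoder), ?_⟩
  refine Matrix.ext_of_mulVec_single fun a => ?_
  have h : (P * B.encoder) *ᵥ Pi.single a 1 ∈ Q.codeSpace := by
    intro s hs
    rw [Matrix.mulVec_mulVec, ← Matrix.mul_assoc, ← (hP s hs).eq, Matrix.mul_assoc,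
      B.stabilizer_mul_encoder hs]
  rw [← B.isEncoder.range_eq] at h
  obtain ⟨v, hv⟩ := h
  rw [Matrix.mulVecLin_apply] at hv
  rw [← Matrix.mulVec_mulVec (Pi.single a 1) B.encoder,
    ← Matrix.mulVec_mulVec (Pi.single a 1) B.encoderᴴ, ← hv,
    Matrix.mulVec_mulVec v, B.isEncoder.isometry, Matrix.one_mulVec]

/-- On the code space `F` is a nonzero scalar, hence commutes with `P`, which preserves that space
and is invertible. The commutation factor must then be trivial. -/
theorem SymplecticBasis.eq_one_of_fix {F P : Op (Fin n)} {c r : ℂ} (hc : c ≠ 0)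
    (hF : F * B.encoder = c • B.encoder) (hPP : P * P = 1)
    (hP : ∀ s ∈ Q.stabilizers, Commute P s) (hFP : F * P = r • (P * F)) : r = 1 := by
  obtain ⟨M, hM⟩ := B.exists_mul_encoder hP
  have h1 : F * (P * B.encoder) = c • (P * B.encoder) := by
    rw [hM, ← Matrix.mul_assoc, hF, Matrix.smul_mul]
  rw [← Matrix.mul_assoc, hFP, Matrix.smul_mul, Matrix.mul_assoc, hF, Matrix.mul_smul,
    smul_smul] at h1
  have h2 := congrArg (fun M : Matrix (Fin n → Fin 2) (Fin k → Fin 2) ℂ => P * M) h1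
  simp only [Matrix.mul_smul, ← Matrix.mul_assoc, hPP, Matrix.one_mul] at h2
  have h3 := B.smul_encoder_injective h2
  exact mul_right_cancel₀ hc (by rw [h3, one_mul])

/-- A Pauli operator that acts on the code space as a scalar is a stabilizer up to a phase. -/
theorem SymplecticBasis.mem_checks_of_fix {x z : Fin n → ZMod 2} {c : ℂ} (hc : c ≠ 0)
    (h : pauliX x * pauliZ z * B.encoder = c • B.encoder) : x ∈ Q.checks ∧ z ∈ Q.checks := by
  constructor
  -- The X-part is tested against Z(y) with y in the dual of C: such a Z(y) preserves the code
  -- space, so its commutation sign (-1)^(x · y) is 1. The Z-part is tested in the same way against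
  -- X(y).
  · refine Q.mem_checks_of_dual fun y hy => ?_
    have := B.eq_one_of_fix hc h (pauliZ_mul_self y) (Q.commute_pauliZ hy) (r := sgn (x ⬝ᵥ y)) ?_
    · exact sgn_injective (this.trans (by simp [sgn]))
    · rw [← mul_assoc, pauliZ_mul_pauliX, Matrix.smul_mul, smul_smul, dotProduct_comm y x,
        sgn_mul_self, one_smul, mul_assoc, mul_assoc, ← pauliZ_add, ← pauliZ_add, add_comm]
  · refine Q.mem_checks_of_dual fun y hy => ?_
    have := B.eq_one_of_fix hc h (pauliX_mul_self y) (Q.commute_pauliX hy) (r := sgn (z ⬝ᵥ y)) ?_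
    · exact sgn_injective (this.trans (by simp [sgn]))
    · rw [mul_assoc, pauliZ_mul_pauliX, Matrix.mul_smul, ← mul_assoc, ← mul_assoc, ← pauliX_add,
        ← pauliX_add, add_comm]

/-- Each logical Pauli operator is implemented by a physical one. -/
theorem SymplecticBasis.exists_isPauli (x z : Fin k → ZMod 2) :
    ∃ P : Op (Fin n), IsPauli P ∧ P * B.encoder = B.encoder * (pauliX x * pauliZ z) := by
  have hmul : ∀ {U V : Op (Fin k)}, (∃ P : Op (Fin n), IsPauli P ∧ P * B.encoder = B.encoder * U) →
      (∃ P : Op (Fin n), IsPauli P ∧ P * B.encoder = B.encoder * V) →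
      ∃ P : Op (Fin n), IsPauli P ∧ P * B.encoder = B.encoder * (U * V) := by
    rintro U V ⟨P, hP, h⟩ ⟨P', hP', h'⟩
    exact ⟨P * P', hP.mul hP', by
      rw [Matrix.mul_assoc, h', ← Matrix.mul_assoc, h, Matrix.mul_assoc]⟩
  have hone : ∃ P : Op (Fin n), IsPauli P ∧ P * B.encoder = B.encoder * (1 : Op (Fin k)) :=
    ⟨1, IsPauli.one, by simp⟩
  apply hmul
  · induction x using zmod_two_pi_induction with
    | zero => rwa [pauliX_zero]
    | add a b ha hb => rw [pauliX_add]; exact hmul ha hb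
    | single j => exact ⟨B.X j, B.isPauli_X j, (B.isEncoder.map_X j).symm⟩
  · induction z using zmod_two_pi_induction with
    | zero => rwa [pauliZ_zero]
    | add a b ha hb => rw [pauliZ_add]; exact hmul ha hb
    | single j => exact ⟨B.Z j, B.isPauli_Z j, (B.isEncoder.map_Z j).symm⟩

variable {B}

/-- The logical `Z` operators of a compatible basis are of pure `Z`-type, up to stabilizers and
signs. -/
theorem SymplecticBasis.IsCompatible.exists_Z (hB : B.IsCompatible) (j : Fin k) :
    ∃ (u : Fin n → ZMod 2) (e : ZMod 2),
      pauliZ u * B.encoder = sgn e • (B.encoder * pauliZ (Pi.single j 1)) := by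
  obtain ⟨c, x, z, hZ⟩ := B.isPauli_Z j
  obtain ⟨b, φ, hφ, hS⟩ := hB.phase 1
  have hφ0 : φ ≠ 0 := by rintro rfl; simp at hφ
  obtain ⟨r, hr, hSX⟩ := tensor_phasePow_mul_pauliX b x
  have hSZ := tensor_phasePow_mul_pauliZ b z
  have hinv := tensor_phasePow_mul_conjTranspose (1 : Fin k → ℤˣ)
  have hcomm := tensor_phasePow_mul_pauliZ (1 : Fin k → ℤˣ) (Pi.single j 1)
  generalize tensor (fun i => phasePow (b i)) = S at *
  generalize tensor (fun j => phasePow ((1 : Fin k → ℤˣ) j)) = S' at *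
  generalize tensor (fun j => (phasePow ((1 : Fin k → ℤˣ) j))ᴴ) = T at *
  have hE : B.Z j * B.encoder = B.encoder * pauliZ (Pi.single j 1) := (B.isEncoder.map_Z j).symm
  -- Moving S past the logical Z costs nothing on the encoded states (`h1`), but as operators it
  -- produces an extra factor r Z(x) (`h2`). Comparison makes Z(x) a scalar on the code space.
  have hx : x ∈ Q.checks := by
    have h1 : S * (B.Z j * B.encoder) = B.Z j * (S * B.encoder) := by
      rw [hE, ← Matrix.mul_assoc, hS, Matrix.mul_smul, ← Matrix.mul_assoc, hE, Matrix.smul_mul,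
        Matrix.mul_assoc, Matrix.mul_assoc, hcomm]
    have h2 : S * B.Z j = r • (B.Z j * (pauliZ x * S)) := by
      rw [hZ, Matrix.mul_smul, ← mul_assoc, hSX, Matrix.smul_mul, mul_assoc _ S, hSZ,
        Matrix.smul_mul, smul_comm, mul_assoc, mul_assoc, ← mul_assoc (pauliZ x),
        ← mul_assoc (pauliZ z), ← pauliZ_add, ← pauliZ_add, add_comm]
    -- The involution `B.Z j` on the left and the inverse `T` of the logical phase gates on the
    -- right strip the equation down to r Z(x) E = E, up to the factor `φ`.
    have h3 := congrArg (fun M : Matrix (Fin n → Fin 2) (Fin k → Fin 2) ℂ => B.Z j * M * T) h1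
    rw [← Matrix.mul_assoc S, h2] at h3
    simp only [Matrix.smul_mul, Matrix.mul_smul, ← Matrix.mul_assoc,
      (B.isPauli_Z j).mul_self (B.isHermitian_Z j), Matrix.one_mul] at h3
    rw [Matrix.mul_assoc (pauliZ x), hS, Matrix.mul_smul, Matrix.smul_mul, Matrix.smul_mul,
      ← Matrix.mul_assoc, Matrix.mul_assoc _ S', Matrix.mul_assoc _ S', hinv, smul_comm,
      Matrix.mul_one, Matrix.mul_one] at h3
    have h4 : r • (pauliZ x * B.encoder) = B.encoder := smul_right_injective _ hφ0 h3
    refine (B.mem_checks_of_fix (x := 0) (z := x) (inv_ne_zero hr) ?_).2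
    rw [pauliX_zero, one_mul]
    conv_rhs => rw [← h4]
    rw [smul_smul, inv_mul_cancel₀ hr, one_smul]
  -- Now X(x) is a stabilizer and can be dropped; moving it past Z(z) contributes the sign in the
  -- witness.
  obtain ⟨α, hα⟩ : ∃ α : ℂ, B.Z j * B.encoder = α • (pauliZ z * B.encoder) := by
    refine ⟨Complex.I ^ c * sgn (z ⬝ᵥ x), ?_⟩
    rw [← B.stabilizer_mul_encoder (Q.pauliX_mem_stabilizers hx), ← Matrix.mul_assoc (pauliZ z),
      pauliZ_mul_pauliX, Matrix.smul_mul, smul_smul, mul_assoc, sgn_mul_self, mul_one,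
      B.stabilizer_mul_encoder (Q.pauliX_mem_stabilizers hx), hZ, Matrix.smul_mul]
  -- `B.Z j` and Z(z) are both involutions, so the scalar relating them on the code space is a sign.
  have hαα : α * α = 1 := by
    apply B.smul_encoder_injective
    have h1 : B.Z j * (B.Z j * B.encoder) = B.encoder := by
      rw [← Matrix.mul_assoc, (B.isPauli_Z j).mul_self (B.isHermitian_Z j), Matrix.one_mul]
    have h2 : pauliZ z * (pauliZ z * B.encoder) = B.encoder := by
      rw [← Matrix.mul_assoc, pauliZ_mul_self, Matrix.one_mul]
    have h3 : B.Z j * (B.Z j * B.encoder) = (α * α) • B.encoder := by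
      rw [hE, ← Matrix.mul_assoc, hα, Matrix.smul_mul, Matrix.mul_assoc, ← hE, hα,
        Matrix.mul_smul, h2, smul_smul]
    rw [← h3, h1, one_smul]
  obtain ⟨e, rfl⟩ := exists_sgn_eq hαα
  exact ⟨z, e, by rw [← hE, hα, smul_smul, sgn_mul_self, one_smul]⟩

/-- The logical `X` operator of a compatible basis is of pure `X`-type, with the same support and
sign as the corresponding `Z` operator. -/
theorem SymplecticBasis.IsCompatible.map_X_of_map_Z (hB : B.IsCompatible) {j : Fin k}
    {u : Fin n → ZMod 2} {c : ℂ}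
    (h : pauliZ u * B.encoder = c • (B.encoder * pauliZ (Pi.single j 1))) :
    pauliX u * B.encoder = c • (B.encoder * pauliX (Pi.single j 1)) := by
  obtain ⟨φ, hφ, hH⟩ := hB.hadamard
  have hφ0 : φ ≠ 0 := by rintro rfl; simp at hφ
  have h1 := tensor_hadamard_mul_pauliZ u
  have h2 := tensor_hadamard_mul_pauliZ (Pi.single j 1 : Fin k → ZMod 2)
  have hinv : tensor (fun _ : Fin k => Multilevel.hadamard) *
      tensor (fun _ => Multilevel.hadamard) = 1 := by
    simp only [tensor_mul, hadamard_mul_self, tensor_one]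
  generalize tensor (fun _ : Fin n => Multilevel.hadamard) = S at *
  generalize tensor (fun _ : Fin k => Multilevel.hadamard) = T at *
  -- Hadamard gates exchange X and Z both physically and logically, so the hypothesis on Z is
  -- carried to X with the same scalar `c`.
  have h3 : pauliX u * (S * B.encoder) * T = φ • (c • (B.encoder * pauliX (Pi.single j 1))) := by
    rw [← Matrix.mul_assoc, ← h1, Matrix.mul_assoc S, h, Matrix.mul_smul, ← Matrix.mul_assoc, hH,
      Matrix.smul_mul, Matrix.smul_mul, Matrix.mul_assoc B.encoder, h2, Matrix.smul_mul,
      Matrix.mul_assoc, Matrix.mul_assoc, hinv, Matrix.mul_one, smul_comm]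
  rw [hH, Matrix.mul_smul, Matrix.smul_mul, Matrix.mul_assoc, Matrix.mul_assoc, hinv,
    Matrix.mul_one] at h3
  exact smul_right_injective _ hφ0 h3

/-- The dual of the check space is spanned by the checks and the supports of the logical operators
of a compatible basis. -/
theorem SymplecticBasis.mem_sup_span_of_dual {u : Fin k → Fin n → ZMod 2} {e : Fin k → ZMod 2}
    (hZ : ∀ j, pauliZ (u j) * B.encoder = sgn (e j) • (B.encoder * pauliZ (Pi.single j 1)))
    (hX : ∀ j, pauliX (u j) * B.encoder = sgn (e j) • (B.encoder * pauliX (Pi.single j 1)))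
    {y : Fin n → ZMod 2} (hy : ∀ g ∈ Q.checks, g ⬝ᵥ y = 0) :
    y ∈ Q.checks ⊔ Submodule.span (ZMod 2) (Set.range u) := by
  set W := Q.checks ⊔ Submodule.span (ZMod 2) (Set.range u)
  have hC : ∀ {x}, x ∈ Q.checks → x ∈ W := fun hx => Submodule.mem_sup_left hx
  have hu : ∀ j, u j ∈ W := fun j => Submodule.mem_sup_right (Submodule.subset_span ⟨j, rfl⟩)
  -- Since X(y) centralizes the stabilizers, it is a product of the generators. X-parts add under
  -- multiplication, so it suffices that those of the generators lie in `W`.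
  have key : ∀ P ∈ Submonoid.closure
      (Q.stabilizers ∪ {Complex.I • (1 : Op (Fin n))} ∪ Set.range B.X ∪ Set.range B.Z),
      ∃ (c : ℂ) (x z : Fin n → ZMod 2), P = c • (pauliX x * pauliZ z) ∧ x ∈ W := by
    intro P hP
    induction hP using Submonoid.closure_induction with
    | mem P hP =>
      rcases hP with ((⟨g, hg, h, hh, rfl⟩ | rfl) | ⟨j, rfl⟩) | ⟨j, rfl⟩
      · exact ⟨1, g, h, (one_smul _ _).symm, hC hg⟩
      · exact ⟨Complex.I, 0, 0, by rw [pauliX_zero, pauliZ_zero, mul_one], W.zero_mem⟩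
      · obtain ⟨c, x, z, h⟩ := B.isPauli_X j
        refine ⟨_, x, z, h, ?_⟩
        have hI : Complex.I ^ c ≠ 0 := pow_ne_zero _ Complex.I_ne_zero
        -- X(u_j) undoes the logical X up to a sign, so the product is a scalar on the code space
        -- and its X-part u_j + x is a check.
        have h1 : Complex.I ^ c • (pauliX (u j + x) * pauliZ z * B.encoder) =
            sgn (e j) • B.encoder := by
          rw [pauliX_add, ← Matrix.smul_mul, mul_assoc, ← Matrix.mul_smul, ← h, Matrix.mul_assoc,
            ← B.isEncoder.map_X, ← Matrix.mul_assoc, hX, Matrix.smul_mul, Matrix.mul_assoc,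
            pauliX_mul_self, Matrix.mul_one]
        have h2 : u j + x ∈ Q.checks := by
          refine (B.mem_checks_of_fix (z := z)
            (mul_ne_zero (inv_ne_zero hI) (sgn_ne_zero (e j))) ?_).1
          rw [← smul_smul, ← h1, smul_smul, inv_mul_cancel₀ hI, one_smul]
        exact (W.add_mem_iff_right (hu j)).mp (hC h2)
      · obtain ⟨c, x, z, h⟩ := B.isPauli_Z j
        refine ⟨_, x, z, h, ?_⟩
        have hI : Complex.I ^ c ≠ 0 := pow_ne_zero _ Complex.I_ne_zero
        -- Z(u_j) undoes the logical Z without changing the X-part, so `x` itself is a check.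
        have h1 : Complex.I ^ c • (pauliX x * pauliZ (z + u j) * B.encoder) =
            sgn (e j) • B.encoder := by
          rw [pauliZ_add, ← mul_assoc, Matrix.mul_assoc, hZ, Matrix.mul_smul, ← Matrix.mul_assoc,
            smul_comm, ← Matrix.smul_mul (Complex.I ^ c), ← Matrix.smul_mul (Complex.I ^ c), ← h,
            ← B.isEncoder.map_Z, Matrix.mul_assoc, pauliZ_mul_self, Matrix.mul_one]
        refine hC (B.mem_checks_of_fix (z := z + u j)
            (mul_ne_zero (inv_ne_zero hI) (sgn_ne_zero (e j))) ?_).1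
        rw [← smul_smul, ← h1, smul_smul, inv_mul_cancel₀ hI, one_smul]
    | one => exact ⟨1, 0, 0, by rw [pauliX_zero, pauliZ_zero, mul_one, one_smul], W.zero_mem⟩
    | mul P P' _ _ h h' =>
      obtain ⟨c, x, z, rfl, hx⟩ := h
      obtain ⟨c', x', z', rfl, hx'⟩ := h'
      exact ⟨_, x + x', z + z', by rw [smul_mul_smul_comm, pauli_mul_pauli, smul_smul],
        W.add_mem hx hx'⟩
  obtain ⟨c, x, z, h, hx⟩ := key _ (B.generate _ (isPauli_pauliX y) (Q.commute_pauliX hy))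
  have : y = x := pauliX_part_unique (z := 0) (c := c) (z' := z) (by rw [pauliZ_zero, mul_one, h])
  rwa [this]

/-- Operators of pure X-type multiply without phases, so the signs of the generators combine to a
character of `p`, namely (-1)^(e · p). -/
theorem SymplecticBasis.exists_logical_of_mem {u : Fin k → Fin n → ZMod 2} {e : Fin k → ZMod 2}
    (hX : ∀ j, pauliX (u j) * B.encoder = sgn (e j) • (B.encoder * pauliX (Pi.single j 1)))
    {w : Fin n → ZMod 2} (hw : w ∈ Q.checks ⊔ Submodule.span (ZMod 2) (Set.range u)) :
    ∃ p : Fin k → ZMod 2,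
      pauliX w * B.encoder = sgn (e ⬝ᵥ p) • (B.encoder * pauliX p) := by
  have h0 : ∀ g ∈ Q.checks,
      pauliX g * B.encoder = sgn (e ⬝ᵥ 0) • (B.encoder * pauliX (0 : Fin k → ZMod 2)) := by
    intro g hg
    rw [B.stabilizer_mul_encoder (Q.pauliX_mem_stabilizers hg), dotProduct_zero, pauliX_zero,
      Matrix.mul_one]
    simp [sgn]
  rw [← Submodule.span_eq Q.checks, ← Submodule.span_union] at hw
  induction hw using Submodule.span_induction with
  | mem x hx =>
    rcases hx with hx | ⟨j, rfl⟩
    · exact ⟨0, h0 x hx⟩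
    · exact ⟨Pi.single j 1, by rw [hX, dotProduct_single_one]⟩
  | zero => exact ⟨0, h0 0 Q.checks.zero_mem⟩
  | add x y _ _ hx hy =>
    obtain ⟨p, hp⟩ := hx
    obtain ⟨q, hq⟩ := hy
    refine ⟨p + q, ?_⟩
    rw [pauliX_add, Matrix.mul_assoc, hq, Matrix.mul_smul, ← Matrix.mul_assoc, hp, Matrix.smul_mul,
      smul_smul, Matrix.mul_assoc, ← pauliX_add, dotProduct_add, sgn_add, mul_comm]
  | smul a x _ hx =>
    rcases zmod_two_cases a with rfl | rfl
    · rw [zero_smul]; exact ⟨0, h0 0 Q.checks.zero_mem⟩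
    · rwa [one_smul]

/-- The commutation sign of Z(u) and X(w) can be computed physically, as (-1)^(u · w), or logically,
as (-1)^(p_j). -/
theorem SymplecticBasis.logical_eq {u : Fin n → ZMod 2} {j : Fin k} {c : ℂ} (hc : c ≠ 0)
    (hZ : pauliZ u * B.encoder = c • (B.encoder * pauliZ (Pi.single j 1)))
    {w : Fin n → ZMod 2} {p : Fin k → ZMod 2} {s : ℂ} (hs : s ≠ 0)
    (hw : pauliX w * B.encoder = s • (B.encoder * pauliX p)) : u ⬝ᵥ w = p j := by
  have h1 : pauliZ u * (pauliX w * B.encoder) =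
      (sgn (p j) * (s * c)) • (B.encoder * (pauliX p * pauliZ (Pi.single j 1))) := by
    rw [hw, Matrix.mul_smul, ← Matrix.mul_assoc, hZ, Matrix.smul_mul, Matrix.mul_assoc,
      pauliZ_mul_pauliX, single_one_dotProduct, Matrix.mul_smul, smul_smul, smul_smul]
    congr 1; ring
  have h2 : pauliZ u * (pauliX w * B.encoder) =
      (sgn (u ⬝ᵥ w) * (s * c)) • (B.encoder * (pauliX p * pauliZ (Pi.single j 1))) := by
    rw [← Matrix.mul_assoc, pauliZ_mul_pauliX, Matrix.smul_mul, Matrix.mul_assoc, hZ,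
      Matrix.mul_smul, ← Matrix.mul_assoc, hw, Matrix.smul_mul, Matrix.mul_assoc, smul_smul,
      smul_smul]
    congr 1; ring
  have h3 := congrArg (fun M : Matrix (Fin n → Fin 2) (Fin k → Fin 2) ℂ =>
    M * (pauliZ (Pi.single j 1) * pauliX p)) (h1.symm.trans h2)
  have h4 : pauliX p * pauliZ (Pi.single j 1) * (pauliZ (Pi.single j 1) * pauliX p) = 1 := by
    rw [mul_assoc, ← mul_assoc (pauliZ _), pauliZ_mul_self, one_mul, pauliX_mul_self]
  simp only [Matrix.smul_mul, Matrix.mul_assoc B.encoder, h4, Matrix.mul_one] at h3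
  have h5 := B.smul_encoder_injective h3
  exact (sgn_injective (mul_right_cancel₀ (mul_ne_zero hs hc) h5)).symm

end SingleCode

/-! ### Two registers and the CNOT gate in the computational basis -/

theorem mul_apply_of_forall_eq_ite {α β γ : Type*} [Fintype β] [DecidableEq β]
    {M : Matrix α β ℂ} {N : Matrix β γ ℂ} {i : β} {j : γ} {g : ℂ}
    (h : ∀ i', N i' j = if i' = i then g else 0) (r : α) : (M * N) r j = M r i * g := by
  simp [Matrix.mul_apply, h]

theorem mul_apply_of_forall_eq_ite_left {α β γ : Type*} [Fintype β] [DecidableEq β]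
    {M : Matrix α β ℂ} {N : Matrix β γ ℂ} {i : β} {r : α} {g : ℂ}
    (h : ∀ i', M r i' = if i' = i then g else 0) (j : γ) : (M * N) r j = g * N i j := by
  simp [Matrix.mul_apply, h]

section TwoRegisters

variable {ι : Type} [Fintype ι]

theorem tensor₂_mul [DecidableEq ι] (F F' : ι → Matrix (Fin 2 × Fin 2) (Fin 2 × Fin 2) ℂ) :
    tensor₂ F * tensor₂ F' = tensor₂ fun i => F i * F' i := by
  ext x y
  simp only [tensor₂, Matrix.mul_apply, Matrix.of_apply, ← Finset.prod_mul_distrib]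
  rw [Finset.prod_univ_sum, Fintype.piFinset_univ]
  exact Fintype.sum_equiv (Equiv.arrowProdEquivProdArrow ι _ _).symm _ _ fun z => rfl

theorem tensor₂_kronecker (G G' : ι → Matrix (Fin 2) (Fin 2) ℂ) :
    tensor₂ (fun i => G i ⊗ₖ G' i) = tensor G ⊗ₖ tensor G' := by
  ext x y
  simp [tensor₂, tensor, Finset.prod_mul_distrib]

theorem tensor₂_one [DecidableEq ι] :
    tensor₂ (fun _ : ι => (1 : Matrix (Fin 2 × Fin 2) (Fin 2 × Fin 2) ℂ)) = 1 := by
  have := tensor₂_kronecker (fun _ : ι => (1 : Matrix (Fin 2) (Fin 2) ℂ)) fun _ => 1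
  simpa [tensor_one] using this

theorem tensor₂_smul (r : ι → ℂ) (F : ι → Matrix (Fin 2 × Fin 2) (Fin 2 × Fin 2) ℂ) :
    tensor₂ (fun i => r i • F i) = (∏ i, r i) • tensor₂ F := by
  ext x y
  simp [tensor₂, Finset.prod_mul_distrib]

theorem fin_two_eq_add_iff (a b c : Fin 2) : a = b + c ↔ c = b + a := by
  revert a b c; decide

theorem tensor₂_cnot_apply [DecidableEq ι] (x y a b : ι → Fin 2) :
    tensor₂ (fun _ : ι => cnot) (x, y) (a, b) = if x = a ∧ y = a + b then 1 else 0 := by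
  simp only [tensor₂, Matrix.of_apply, cnot, Prod.mk.injEq]
  rw [Finset.prod_ite_zero]
  simp [funext_iff, forall_and]

theorem tensor₂_cnot_mul_apply [DecidableEq ι] {κ : Type*}
    (M : Matrix ((ι → Fin 2) × (ι → Fin 2)) κ ℂ) (x y : ι → Fin 2) (c : κ) :
    (tensor₂ (fun _ : ι => cnot) * M) (x, y) c = M (x, x + y) c := by
  rw [mul_apply_of_forall_eq_ite_left (i := (x, x + y)) (g := 1), one_mul]
  rintro ⟨a, b⟩
  rw [tensor₂_cnot_apply]
  refine if_congr ?_ rfl rfl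
  rw [Prod.mk.injEq, eq_comm (a := x)]
  refine and_congr_right ?_
  rintro rfl
  simp only [funext_iff, Pi.add_apply]
  exact forall_congr' fun i => fin_two_eq_add_iff _ _ _

theorem mul_tensor₂_cnot_apply [DecidableEq ι] {κ : Type*}
    (M : Matrix κ ((ι → Fin 2) × (ι → Fin 2)) ℂ) (c : κ) (a b : ι → Fin 2) :
    (M * tensor₂ (fun _ : ι => cnot)) c (a, b) = M c (a, a + b) := by
  rw [mul_apply_of_forall_eq_ite (i := (a, a + b)) (g := 1), mul_one]
  rintro ⟨x, y⟩
  simp only [tensor₂_cnot_apply, Prod.mk.injEq]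

theorem mul_pauliZ_kronecker_pauliX_apply [DecidableEq ι] {κ : Type*}
    (M : Matrix κ ((ι → Fin 2) × (ι → Fin 2)) ℂ) (z x : ι → ZMod 2) (c : κ) (a b : ι → Fin 2) :
    (M * (pauliZ z ⊗ₖ pauliX x)) c (a, b) =
      M c (a, bits.symm (bits b + x)) * sgn (z ⬝ᵥ bits a) := by
  apply mul_apply_of_forall_eq_ite
  rintro ⟨a', b'⟩
  rw [kroneckerMap_apply, pauliX_apply, pauliZ_eq_diagonal, diagonal_apply]
  simp only [Prod.mk.injEq, Equiv.eq_symm_apply]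
  by_cases h : a' = a <;> by_cases h' : bits b' = bits b + x <;> simp [h, h']

end TwoRegisters

/-! ### The transversal CNOT on two blocks of one code -/

section SingleCode

variable {n k : ℕ} {Q : SelfDualCSS n k} {B : SymplecticBasis Q}

/-- The transversal CNOT gate on two blocks of a code with a compatible basis implements the CNOT
gates on all logical qubits, up to a logical Pauli operator: the latter is needed if some of the
logical operators have a negative sign. -/
theorem SymplecticBasis.IsCompatible.exists_cnot (hB : B.IsCompatible) :
    ∃ (e : Fin k → ZMod 2) (φ : ℂ), ‖φ‖ = 1 ∧
      tensor₂ (fun _ : Fin n => cnot) * (B.encoder ⊗ₖ B.encoder) =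
        φ • ((B.encoder ⊗ₖ B.encoder) *
          (tensor₂ (fun _ : Fin k => cnot) * (pauliZ e ⊗ₖ pauliX e))) := by
  choose u e hZ using hB.exists_Z
  have hX := fun j => hB.map_X_of_map_Z (hZ j)
  refine ⟨e, sgn (e ⬝ᵥ e), norm_sgn _, ?_⟩
  ext ⟨x, y⟩ ⟨a, b⟩
  rw [tensor₂_cnot_mul_apply, Matrix.smul_apply, ← Matrix.mul_assoc,
    mul_pauliZ_kronecker_pauliX_apply, mul_tensor₂_cnot_apply]
  simp only [kroneckerMap_apply, smul_eq_mul]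
  -- Both sides contain the factor E(x, a), so only `x` in the support of E|a⟩ matters. There the
  -- stabilizers and logical operators of Z-type, being diagonal, determine g · x and u_j · x.
  by_cases h0 : B.encoder x a = 0
  · simp [h0]
  have hdual : ∀ g ∈ Q.checks, g ⬝ᵥ bits x = 0 := by
    intro g hg
    have h1 := congrFun (congrFun (B.stabilizer_mul_encoder (Q.pauliZ_mem_stabilizers hg)) x) a
    rw [pauliZ_eq_diagonal, diagonal_mul] at h1
    exact sgn_injective ((mul_eq_right₀ h0).mp h1 |>.trans (by simp [sgn]))
  have hu : ∀ j, u j ⬝ᵥ bits x = e j + bits a j := by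
    intro j
    have h1 := congrFun (congrFun (hZ j) x) a
    rw [pauliZ_eq_diagonal, diagonal_mul, pauliZ_single_apply, Matrix.smul_apply, mul_diagonal,
      smul_eq_mul, mul_comm (B.encoder x a), ← mul_assoc, ← sgn_add] at h1
    exact sgn_injective (mul_right_cancel₀ h0 h1)
  -- The CNOT adds `x` to the second register, that is, it applies X(x), which is a logical X
  -- operator because `x` lies in the dual of C.
  obtain ⟨p, hp⟩ := B.exists_logical_of_mem hX (B.mem_sup_span_of_dual hZ hX hdual)
  have hpe : p = e + bits a := funext fun j => by
    rw [← B.logical_eq (sgn_ne_zero _) (hZ j) (sgn_ne_zero _) hp, hu, Pi.add_apply]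
  have h2 := congrFun (congrFun hp y) b
  rw [pauliX_mul_apply, Matrix.smul_apply, mul_pauliX_apply, smul_eq_mul, hpe, dotProduct_add,
    sgn_add] at h2
  have h3 : bits.symm (bits y + bits x) = x + y := add_comm (bits y) (bits x)
  have h4 : bits.symm (bits b + (e + bits a)) = a + bits.symm (bits b + e) := by
    change bits b + (e + bits a) = bits a + (bits b + e)
    abel
  rw [h3, h4] at h2
  rw [h2]
  ring

end SingleCode

/-! ### Registers that are divided into blocks -/

section Blocks

/-- `⨂ b, M b`: the operator `M b` maps the states of the `b`-th block of the source to those of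
the `b`-th block of the target. -/
def blockTensor {β S T : Type} [Fintype β] (M : β → Matrix S T ℂ) : Matrix (β → S) (β → T) ℂ :=
  Matrix.of fun x y => ∏ b, M b (x b) (y b)

theorem blockTensor_mul {β S T R : Type} [Fintype β] [DecidableEq β] [Fintype T]
    (M : β → Matrix S T ℂ) (N : β → Matrix T R ℂ) :
    blockTensor M * blockTensor N = blockTensor fun b => M b * N b := by
  ext x y
  simp only [blockTensor, Matrix.mul_apply, Matrix.of_apply, ← Finset.prod_mul_distrib]
  rw [Finset.prod_univ_sum, Fintype.piFinset_univ]

theorem blockTensor_smul {β S T : Type} [Fintype β] (r : β → ℂ) (M : β → Matrix S T ℂ) :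
    blockTensor (fun b => r b • M b) = (∏ b, r b) • blockTensor M := by
  ext x y
  simp [blockTensor, Finset.prod_mul_distrib]

/-- Basis labels of a register that is divided into blocks. -/
def regroup {β κ ι : Type} (e : β × κ ≃ ι) : (ι → Fin 2) ≃ (β → κ → Fin 2) :=
  (e.symm.arrowCongr (Equiv.refl _)).trans (Equiv.curry β κ (Fin 2))

/-- Basis labels of two registers that are divided into blocks. -/
def regroup₂ {β κ ι : Type} (e : β × κ ≃ ι) :
    (ι → Fin 2) × (ι → Fin 2) ≃ (β → (κ → Fin 2) × (κ → Fin 2)) :=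
  ((regroup e).prodCongr (regroup e)).trans (Equiv.arrowProdEquivProdArrow β _ _).symm

theorem tensor_eq_submatrix {β κ ι : Type} [Fintype β] [Fintype κ] [Fintype ι]
    (e : β × κ ≃ ι) (G : ι → Matrix (Fin 2) (Fin 2) ℂ) :
    tensor G = (blockTensor fun b => tensor fun i => G (e (b, i))).submatrix
      (regroup e) (regroup e) := by
  ext x y
  simp only [tensor, blockTensor, Matrix.of_apply, Matrix.submatrix_apply]
  rw [← Fintype.prod_prod_type']
  exact (Fintype.prod_equiv e _ _ fun _ => rfl).symm

theorem tensor₂_eq_submatrix {β κ ι : Type} [Fintype β] [Fintype κ] [Fintype ι]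
    (e : β × κ ≃ ι) (F : ι → Matrix (Fin 2 × Fin 2) (Fin 2 × Fin 2) ℂ) :
    tensor₂ F = (blockTensor fun b => tensor₂ fun i => F (e (b, i))).submatrix
      (regroup₂ e) (regroup₂ e) := by
  ext x y
  simp only [tensor₂, blockTensor, Matrix.of_apply, Matrix.submatrix_apply]
  rw [← Fintype.prod_prod_type']
  exact (Fintype.prod_equiv e _ _ fun _ => rfl).symm

/-- The map `E` applied to each block. -/
def blockEncoder {β κ κ' ι ι' : Type} [Fintype β] (e : β × κ ≃ ι) (e' : β × κ' ≃ ι')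
    (E : Matrix (κ → Fin 2) (κ' → Fin 2) ℂ) : Matrix (ι → Fin 2) (ι' → Fin 2) ℂ :=
  Matrix.of fun x y => ∏ b, E (fun i => x (e (b, i))) (fun j => y (e' (b, j)))

variable {β κ κ' ι ι' : Type} [Fintype β] [DecidableEq β] [Fintype κ] [DecidableEq κ]
  [Fintype κ'] [DecidableEq κ'] [Fintype ι] [DecidableEq ι] [Fintype ι'] [DecidableEq ι']
  (e : β × κ ≃ ι) (e' : β × κ' ≃ ι')

/-- After regrouping the qubits into blocks, all operators are tensor products over the blocks and
can be multiplied blockwise. The phase may differ from block to block. -/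
theorem tensor_mul_blockEncoder {E : Matrix (κ → Fin 2) (κ' → Fin 2) ℂ}
    {G : ι → Matrix (Fin 2) (Fin 2) ℂ} {G' : ι' → Matrix (Fin 2) (Fin 2) ℂ} {φ : β → ℂ}
    (h : ∀ b, tensor (fun i => G (e (b, i))) * E =
      φ b • (E * tensor fun j => G' (e' (b, j)))) :
    tensor G * blockEncoder e e' E = (∏ b, φ b) • (blockEncoder e e' E * tensor G') := by
  have hE : blockEncoder e e' E =
      (blockTensor fun _ : β => E).submatrix (regroup e) (regroup e') := rfl
  rw [hE, tensor_eq_submatrix e, tensor_eq_submatrix e', submatrix_mul_equiv,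
    submatrix_mul_equiv, blockTensor_mul, blockTensor_mul]
  simp only [h]
  rw [blockTensor_smul]
  rfl

theorem tensor₂_mul_blockEncoder {E : Matrix (κ → Fin 2) (κ' → Fin 2) ℂ}
    {F : ι → Matrix (Fin 2 × Fin 2) (Fin 2 × Fin 2) ℂ}
    {F' : ι' → Matrix (Fin 2 × Fin 2) (Fin 2 × Fin 2) ℂ} {φ : β → ℂ}
    (h : ∀ b, tensor₂ (fun i => F (e (b, i))) * (E ⊗ₖ E) =
      φ b • ((E ⊗ₖ E) * tensor₂ fun j => F' (e' (b, j)))) :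
    tensor₂ F * (blockEncoder e e' E ⊗ₖ blockEncoder e e' E) =
      (∏ b, φ b) • ((blockEncoder e e' E ⊗ₖ blockEncoder e e' E) * tensor₂ F') := by
  have hE : blockEncoder e e' E ⊗ₖ blockEncoder e e' E =
      (blockTensor fun _ : β => E ⊗ₖ E).submatrix (regroup₂ e) (regroup₂ e') := by
    ext x y
    simp only [blockEncoder, blockTensor, kroneckerMap_apply, Matrix.submatrix_apply,
      Matrix.of_apply, ← Finset.prod_mul_distrib]
    rfl
  rw [hE, tensor₂_eq_submatrix e, tensor₂_eq_submatrix e', submatrix_mul_equiv,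
    submatrix_mul_equiv, blockTensor_mul, blockTensor_mul]
  simp only [h]
  rw [blockTensor_smul]
  rfl

end Blocks

/-! ### Levels of a concatenated code -/

section Levels

variable {L : ℕ} {n k : Fin L → ℕ}

/-- The qubits at level `c`, sorted by the blocks of code `c`. -/
def innerEquiv (n k : Fin L → ℕ) (c : Fin L) : Block n k c × Fin (n c) ≃ Idx n k c.val where
  toFun p := p.1.inner p.2
  invFun q := (fun c' => q c', Fin.cast (by simp [size]) (q c))
  left_inv := by
    rintro ⟨b, i⟩
    refine Prod.ext (funext fun c' => ?_) ?_
    · simp [Block.inner, c'.2]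
    · simp [Block.inner]
  right_inv q := by
    funext c'
    by_cases h : c' = c
    · subst h; simp [Block.inner]
    · simp [Block.inner, h]

theorem size_succ_of_ne {c c' : Fin L} (h : c' ≠ c) :
    size n k (c.val + 1) c' = size n k c.val c' := by
  have h1 : c'.val ≠ c.val := fun e => h (Fin.ext e)
  have h2 : c'.val < c.val + 1 ↔ c'.val < c.val := by omega
  simp only [size, h2]

/-- The qubits at level `c + 1`, sorted by the blocks of code `c`. -/
def outerEquiv (n k : Fin L → ℕ) (c : Fin L) :
    Block n k c × Fin (k c) ≃ Idx n k (c.val + 1) where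
  toFun p := p.1.outer p.2
  invFun q := (fun c' => Fin.cast (size_succ_of_ne c'.2) (q c'), Fin.cast (by simp [size]) (q c))
  left_inv := by
    rintro ⟨b, i⟩
    refine Prod.ext (funext fun c' => ?_) ?_
    · simp [Block.outer, c'.2]
    · simp [Block.outer]
  right_inv q := by
    funext c'
    by_cases h : c' = c
    · subst h; simp [Block.outer]
    · simp [Block.outer, h]

variable {Q : ∀ c, SelfDualCSS (n c) (k c)} (B : ∀ c, SymplecticBasis (Q c))

theorem stepEncoder_eq_blockEncoder (c : Fin L) :
    stepEncoder B c = blockEncoder (innerEquiv n k c) (outerEquiv n k c) (B c).encoder := rfl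

theorem levelEncoder_self (m : ℕ) : levelEncoder B (le_refl m) = 1 :=
  Nat.leRecOn_self _

theorem levelEncoder_succ {m l : ℕ} (h : m ≤ l) (hl : l < L) :
    levelEncoder B (h.trans l.le_succ) = levelEncoder B h * stepEncoder B ⟨l, hl⟩ := by
  unfold levelEncoder
  rw [Nat.leRecOn_succ h, dif_pos hl]

variable {B}

/-- A global phase can be absorbed into single-qubit gates only if there is a qubit. Here n ≥ k ≥ 1
for each code. -/
theorem nonempty_idx (Q : ∀ c, SelfDualCSS (n c) (k c)) (hk : ∀ c, 1 ≤ k c) (t : ℕ) :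
    Nonempty (Idx n k t) := by
  refine ⟨fun c => ⟨0, ?_⟩⟩
  have h1 := hk c
  have h2 := (Q c).finrank_checks
  simp only [size]
  split_ifs <;> omega

theorem smul_mem_unitaryGroup {α : Type*} [Fintype α] [DecidableEq α] {φ : ℂ} (hφ : ‖φ‖ = 1)
    {U : Matrix α α ℂ} (hU : U ∈ Matrix.unitaryGroup α ℂ) :
    φ • U ∈ Matrix.unitaryGroup α ℂ := by
  rw [Matrix.mem_unitaryGroup_iff] at hU ⊢
  rw [star_smul, smul_mul_smul_comm, hU, Complex.star_def, Complex.mul_conj,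
    Complex.normSq_eq_norm_sq, hφ]
  simp

theorem exists_prod_eq {ι : Type} [Fintype ι] [Nonempty ι] {φ : ℂ} (hφ : ‖φ‖ = 1) :
    ∃ r : ι → ℂ, (∀ i, ‖r i‖ = 1) ∧ ∏ i, r i = φ := by
  classical
  obtain ⟨i₀⟩ := ‹Nonempty ι›
  refine ⟨fun i => if i = i₀ then φ else 1, fun i => ?_, by simp⟩
  dsimp only
  split_ifs <;> simp [hφ]

section OneBlock

variable {t l : ℕ} {h : t ≤ l}

theorem IsTransversalAt.smul [Nonempty (Idx n k t)] {U : Op (Idx n k l)}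
    (hU : IsTransversalAt B h U) {φ : ℂ} (hφ : ‖φ‖ = 1) : IsTransversalAt B h (φ • U) := by
  obtain ⟨G, hG, hGU⟩ := hU
  obtain ⟨r, hr, rfl⟩ := exists_prod_eq (ι := Idx n k t) hφ
  refine ⟨fun q => r q • G q, fun q => smul_mem_unitaryGroup (hr q) (hG q), ?_⟩
  rw [tensor_smul, Matrix.smul_mul, hGU, Matrix.mul_smul]

/-- The induction step: the encoding from level `l + 1` to `t` factors through level `l`, so the
same physical gates serve for `U'` and `U`, up to the phase `φ`. -/
theorem IsTransversalAt.of_step [Nonempty (Idx n k t)] (hl : l < L) {U' : Op (Idx n k l)}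
    {U : Op (Idx n k (l + 1))} {φ : ℂ} (hφ : ‖φ‖ = 1)
    (hU : U' * stepEncoder B ⟨l, hl⟩ = φ • (stepEncoder B ⟨l, hl⟩ * U))
    (hU' : IsTransversalAt B h U') : IsTransversalAt B (h.trans l.le_succ) U := by
  have hφ0 : φ ≠ 0 := by rintro rfl; simp at hφ
  suffices hs : IsTransversalAt B (h.trans l.le_succ) (φ • U) by
    have := hs.smul (φ := φ⁻¹) (by simp [hφ])
    rwa [smul_smul, inv_mul_cancel₀ hφ0, one_smul] at this
  obtain ⟨G, hG, hGU⟩ := hU'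
  refine ⟨G, hG, ?_⟩
  rw [levelEncoder_succ B h hl, ← Matrix.mul_assoc, hGU, Matrix.mul_assoc, hU, Matrix.mul_assoc,
    Matrix.mul_smul, Matrix.mul_smul, Matrix.mul_smul]

theorem isTransversalAt_self {G : Idx n k t → Matrix (Fin 2) (Fin 2) ℂ}
    (hG : ∀ q, G q ∈ Matrix.unitaryGroup (Fin 2) ℂ) :
    IsTransversalAt B (le_refl t) (tensor G) :=
  ⟨G, hG, by rw [levelEncoder_self, Matrix.one_mul, Matrix.mul_one]⟩

end OneBlock

section TwoBlocks

variable {t l : ℕ} {h : t ≤ l}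

theorem IsTransversalAt₂.smul [Nonempty (Idx n k t)] {V : Op₂ (Idx n k l)}
    (hV : IsTransversalAt₂ B h V) {φ : ℂ} (hφ : ‖φ‖ = 1) : IsTransversalAt₂ B h (φ • V) := by
  obtain ⟨F, hF, hFV⟩ := hV
  obtain ⟨r, hr, rfl⟩ := exists_prod_eq (ι := Idx n k t) hφ
  refine ⟨fun q => r q • F q, fun q => smul_mem_unitaryGroup (hr q) (hF q), ?_⟩
  rw [tensor₂_smul, Matrix.smul_mul, hFV, Matrix.mul_smul]

theorem IsTransversalAt₂.mul {V V' : Op₂ (Idx n k l)} (hV : IsTransversalAt₂ B h V)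
    (hV' : IsTransversalAt₂ B h V') : IsTransversalAt₂ B h (V * V') := by
  obtain ⟨F, hF, hFV⟩ := hV
  obtain ⟨F', hF', hFV'⟩ := hV'
  refine ⟨fun q => F q * F' q, fun q => mul_mem (hF q) (hF' q), ?_⟩
  rw [← tensor₂_mul, Matrix.mul_assoc, hFV', ← Matrix.mul_assoc, hFV, Matrix.mul_assoc]

theorem IsTransversalAt.kronecker {U U' : Op (Idx n k l)} (hU : IsTransversalAt B h U)
    (hU' : IsTransversalAt B h U') : IsTransversalAt₂ B h (U ⊗ₖ U') := by
  obtain ⟨G, hG, hGU⟩ := hU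
  obtain ⟨G', hG', hGU'⟩ := hU'
  refine ⟨fun q => G q ⊗ₖ G' q, fun q => kronecker_mem_unitary (hG q) (hG' q), ?_⟩
  rw [tensor₂_kronecker, ← mul_kronecker_mul, hGU, hGU', mul_kronecker_mul]

theorem IsTransversalAt₂.of_step [Nonempty (Idx n k t)] (hl : l < L) {V' : Op₂ (Idx n k l)}
    {V : Op₂ (Idx n k (l + 1))} {φ : ℂ} (hφ : ‖φ‖ = 1)
    (hV : V' * (stepEncoder B ⟨l, hl⟩ ⊗ₖ stepEncoder B ⟨l, hl⟩) =
      φ • ((stepEncoder B ⟨l, hl⟩ ⊗ₖ stepEncoder B ⟨l, hl⟩) * V))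
    (hV' : IsTransversalAt₂ B h V') : IsTransversalAt₂ B (h.trans l.le_succ) V := by
  have hφ0 : φ ≠ 0 := by rintro rfl; simp at hφ
  suffices hs : IsTransversalAt₂ B (h.trans l.le_succ) (φ • V) by
    have := hs.smul (φ := φ⁻¹) (by simp [hφ])
    rwa [smul_smul, inv_mul_cancel₀ hφ0, one_smul] at this
  obtain ⟨F, hF, hFV⟩ := hV'
  refine ⟨F, hF, ?_⟩
  rw [levelEncoder_succ B h hl, mul_kronecker_mul, ← Matrix.mul_assoc, hFV, Matrix.mul_assoc, hV,
    Matrix.mul_assoc, Matrix.mul_smul, Matrix.mul_smul, Matrix.mul_smul]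

theorem isTransversalAt₂_self {F : Idx n k t → Matrix (Fin 2 × Fin 2) (Fin 2 × Fin 2) ℂ}
    (hF : ∀ q, F q ∈ Matrix.unitaryGroup (Fin 2 × Fin 2) ℂ) :
    IsTransversalAt₂ B (le_refl t) (tensor₂ F) :=
  ⟨F, hF, by rw [levelEncoder_self, kroneckerMap_one_one _ (by simp) (by simp) (by simp),
    Matrix.one_mul, Matrix.mul_one]⟩

end TwoBlocks

end Levels

/-! ### Unitarity of the elementary gates -/

theorem hadamard_mem_unitaryGroup : hadamard ∈ Matrix.unitaryGroup (Fin 2) ℂ := by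
  have h : star hadamard = hadamard := by
    ext i j; fin_cases i <;> fin_cases j <;> simp [hadamard]
  rw [Matrix.mem_unitaryGroup_iff, h, hadamard_mul_self]

theorem phasePow_mem_unitaryGroup (a : ℤˣ) : phasePow a ∈ Matrix.unitaryGroup (Fin 2) ℂ := by
  rw [Matrix.mem_unitaryGroup_iff, star_eq_conjTranspose, phasePow_mul_conjTranspose]

theorem sigmaX_mem_unitaryGroup : sigmaX ∈ Matrix.unitaryGroup (Fin 2) ℂ := by
  have h : star sigmaX = sigmaX := by
    ext i j; fin_cases i <;> fin_cases j <;> simp [sigmaX]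
  rw [Matrix.mem_unitaryGroup_iff, h, sigmaX_mul_self]

theorem sigmaZ_mem_unitaryGroup : sigmaZ ∈ Matrix.unitaryGroup (Fin 2) ℂ := by
  have h : star sigmaZ = sigmaZ := by
    ext i j; fin_cases i <;> fin_cases j <;> simp [sigmaZ]
  rw [Matrix.mem_unitaryGroup_iff, h, sigmaZ_mul_self]

theorem cnot_mem_unitaryGroup : cnot ∈ Matrix.unitaryGroup (Fin 2 × Fin 2) ℂ := by
  have h : star cnot = cnot := by
    ext ⟨a, b⟩ ⟨a', b'⟩
    fin_cases a <;> fin_cases b <;> fin_cases a' <;> fin_cases b' <;>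
      simp [cnot]
  rw [Matrix.mem_unitaryGroup_iff, h]
  ext ⟨a, b⟩ ⟨a', b'⟩
  fin_cases a <;> fin_cases b <;> fin_cases a' <;> fin_cases b' <;>
    simp [cnot, Matrix.mul_apply]

/-- The single-qubit Pauli operators `X ^ a * Z ^ b`. -/
def pauliMatrices : Set (Matrix (Fin 2) (Fin 2) ℂ) :=
  Set.range fun p : ZMod 2 × ZMod 2 =>
    (if p.1 = 1 then sigmaX else 1) * (if p.2 = 1 then sigmaZ else 1)

/-! ### Saturated sets of qubits and the descent through the levels -/

section Levels

variable {L : ℕ} {n k : Fin L → ℕ} {Q : ∀ c, SelfDualCSS (n c) (k c)}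
  {B : ∀ c, SymplecticBasis (Q c)}

/-- A set of qubits at level `l` that contains, with each qubit, all qubits which differ from it
only in the indices that belong to the codes between the levels `t` and `l`. -/
def IsSaturated (t : ℕ) {l : ℕ} (D : Set (Idx n k l)) : Prop :=
  ∀ q₁ q₂ : Idx n k l, (∀ c : Fin L, c.val < t ∨ l ≤ c.val → q₁ c = q₂ c) → q₁ ∈ D → q₂ ∈ D

/-- The qubits at level `c` in those blocks of code `c` that encode qubits in `D`. -/
def lowerSet (c : Fin L) (D : Set (Idx n k (c.val + 1))) : Set (Idx n k c.val) :=
  {q | ∃ j, outerEquiv n k c (((innerEquiv n k c).symm q).1, j) ∈ D}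

theorem innerEquiv_mem_lowerSet {c : Fin L} {D : Set (Idx n k (c.val + 1))} {b : Block n k c}
    {i : Fin (n c)} :
    innerEquiv n k c (b, i) ∈ lowerSet c D ↔ ∃ j, outerEquiv n k c (b, j) ∈ D := by
  simp [lowerSet]

/-- Index `c` is among those that may vary freely, so a block of code `c` encodes either only qubits
of `D` or none. -/
theorem IsSaturated.outerEquiv_mem {t : ℕ} {c : Fin L} (htc : t ≤ c.val)
    {D : Set (Idx n k (c.val + 1))} (hD : IsSaturated t D) {b : Block n k c} {j : Fin (k c)}
    (h : outerEquiv n k c (b, j) ∈ D) (j' : Fin (k c)) : outerEquiv n k c (b, j') ∈ D := by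
  refine hD _ _ (fun c' hc' => ?_) h
  have hne : c' ≠ c := by rintro rfl; omega
  simp [outerEquiv, Block.outer, hne]

theorem IsSaturated.lowerSet {t : ℕ} {c : Fin L} {D : Set (Idx n k (c.val + 1))}
    (hD : IsSaturated t D) : IsSaturated t (lowerSet c D) := by
  rintro q q' h ⟨j, hj⟩
  refine ⟨j, hD _ _ (fun c' hc' => ?_) hj⟩
  by_cases hne : c' = c
  · subst hne; simp [outerEquiv, Block.outer]
  · have := h c' (by omega)
    simp [outerEquiv, innerEquiv, Block.outer, hne, this]

/-- Let `𝒮` be a set of single-qubit gates such that in each of the codes, each product of gates in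
`𝒮` on the logical qubits is implemented by a product of gates in `𝒮` on the physical qubits. Then
the products of gates in `𝒮` on a saturated set of qubits are transversal. -/
theorem isTransversalAt_tensor (hk : ∀ c, 1 ≤ k c) {𝒮 : Set (Matrix (Fin 2) (Fin 2) ℂ)}
    (hU : ∀ g ∈ 𝒮, g ∈ Matrix.unitaryGroup (Fin 2) ℂ)
    (hlift : ∀ c, ∀ G' : Fin (k c) → Matrix (Fin 2) (Fin 2) ℂ, (∀ j, G' j ∈ 𝒮) →
      ∃ G : Fin (n c) → Matrix (Fin 2) (Fin 2) ℂ, (∀ i, G i ∈ 𝒮) ∧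
        (B c).Implements (tensor G) (tensor G'))
    {t l : ℕ} (h : t ≤ l) (hl : l ≤ L) {D : Set (Idx n k l)} (hD : IsSaturated t D)
    {G' : Idx n k l → Matrix (Fin 2) (Fin 2) ℂ} (hin : ∀ q ∈ D, G' q ∈ 𝒮)
    (hout : ∀ q, q ∉ D → G' q = 1) : IsTransversalAt B h (tensor G') := by
  classical
  have := nonempty_idx Q hk t
  induction l, h using Nat.le_induction with
  | base =>
    refine isTransversalAt_self fun q => ?_
    by_cases hq : q ∈ D
    · exact hU _ (hin q hq)
    · rw [hout q hq]; exact one_mem _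
  | succ l h ih =>
    let c : Fin L := ⟨l, hl⟩
    -- By saturation only two kinds of blocks occur: on full ones `hlift` applies, on empty ones the
    -- identity works with phase 1. Both alternatives are recorded because the induction hypothesis
    -- needs them on `lowerSet c D`.
    have key : ∀ b : Block n k c, ∃ (G : Fin (n c) → Matrix (Fin 2) (Fin 2) ℂ) (φ : ℂ), ‖φ‖ = 1 ∧
        ((∃ j, outerEquiv n k c (b, j) ∈ D) → ∀ i, G i ∈ 𝒮) ∧
        ((¬ ∃ j, outerEquiv n k c (b, j) ∈ D) → ∀ i, G i = 1) ∧
        tensor G * (B c).encoder =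
          φ • ((B c).encoder * tensor fun j => G' (outerEquiv n k c (b, j))) := by
      intro b
      by_cases hb : ∃ j, outerEquiv n k c (b, j) ∈ D
      · obtain ⟨j, hj⟩ := hb
        obtain ⟨G, hG, φ, hφ, hGE⟩ := hlift c (fun j => G' (outerEquiv n k c (b, j)))
          fun j' => hin _ (hD.outerEquiv_mem h hj j')
        exact ⟨G, φ, hφ, fun _ => hG, fun hb => absurd ⟨j, hj⟩ hb, hGE⟩
      · refine ⟨fun _ => 1, 1, by simp, fun h => absurd h hb, fun _ _ => rfl, ?_⟩
        have : ∀ j, G' (outerEquiv n k c (b, j)) = 1 := fun j => hout _ fun hj => hb ⟨j, hj⟩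
        simp only [this, tensor_one, Matrix.one_mul, Matrix.mul_one, one_smul]
    choose G φ hφ hGin hGout hGE using key
    let G₀ : Idx n k l → Matrix (Fin 2) (Fin 2) ℂ := fun q =>
      G ((innerEquiv n k c).symm q).1 ((innerEquiv n k c).symm q).2
    have hstep : tensor G₀ * stepEncoder B c = (∏ b, φ b) • (stepEncoder B c * tensor G') := by
      rw [stepEncoder_eq_blockEncoder]
      refine tensor_mul_blockEncoder _ _ fun b => ?_
      rw [← hGE b]
      simp [G₀]
    refine IsTransversalAt.of_step (h := h) hl (φ := ∏ b, φ b)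
      (by rw [norm_prod]; simp [hφ]) hstep ?_
    refine ih (Nat.le_of_succ_le hl) (D := lowerSet c D) hD.lowerSet ?_ ?_
    · intro q hq
      exact hGin _ hq _
    · intro q hq
      exact hGout _ hq _

/-- Logical Pauli operators are physical Pauli operators for any symplectic basis, so no
compatibility is needed. The power of `i` is left to the global phase, which keeps the physical
factors in `pauliMatrices`. -/
theorem isTransversalAt_pauli (hk : ∀ c, 1 ≤ k c) {t l : ℕ} (h : t ≤ l) (hl : l ≤ L)
    {G : Idx n k l → Matrix (Fin 2) (Fin 2) ℂ} (hG : ∀ q, G q ∈ pauliMatrices) :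
    IsTransversalAt B h (tensor G) := by
  refine isTransversalAt_tensor hk (𝒮 := pauliMatrices) ?_ ?_ h hl (D := Set.univ)
    (fun _ _ _ _ => Set.mem_univ _) (fun q _ => hG q) fun q hq => absurd (Set.mem_univ q) hq
  · rintro _ ⟨p, rfl⟩
    refine mul_mem ?_ ?_ <;> split_ifs
    exacts [sigmaX_mem_unitaryGroup, one_mem _, sigmaZ_mem_unitaryGroup, one_mem _]
  · intro c G' hG'
    choose p hp using hG'
    obtain ⟨P, ⟨d, x, z, rfl⟩, hP⟩ := (B c).exists_isPauli (fun j => (p j).1) fun j => (p j).2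
    have hI : Complex.I ^ d ≠ 0 := pow_ne_zero _ Complex.I_ne_zero
    refine ⟨fun i => (if x i = 1 then sigmaX else 1) * (if z i = 1 then sigmaZ else 1),
      fun i => ⟨(x i, z i), rfl⟩, (Complex.I ^ d)⁻¹, by simp, ?_⟩
    have h1 : tensor G' = pauliX (fun j => (p j).1) * pauliZ fun j => (p j).2 := by
      rw [pauliX, pauliZ, tensor_mul]
      exact congrArg tensor (funext fun j => (hp j).symm)
    rw [h1, ← hP, Matrix.smul_mul, smul_smul, inv_mul_cancel₀ hI, one_smul, pauliX, pauliZ,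
      tensor_mul]

theorem isTransversalAt_pauliX (hk : ∀ c, 1 ≤ k c) {t l : ℕ} (h : t ≤ l) (hl : l ≤ L)
    (x : Idx n k l → ZMod 2) : IsTransversalAt B h (pauliX x) :=
  isTransversalAt_pauli hk h hl fun q => ⟨(x q, 0), by simp⟩

theorem isTransversalAt_pauliZ (hk : ∀ c, 1 ≤ k c) {t l : ℕ} (h : t ≤ l) (hl : l ≤ L)
    (z : Idx n k l → ZMod 2) : IsTransversalAt B h (pauliZ z) :=
  isTransversalAt_pauli hk h hl fun q => ⟨(0, z q), by simp⟩

/-- The descent is that of `isTransversalAt_tensor`, except that each step yields the CNOT gates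
times a Pauli operator, which is removed by its own transversality at level `t`. -/
theorem isTransversalAt₂_cnot (hk : ∀ c, 1 ≤ k c) (hB : ∀ c, (B c).IsCompatible)
    {t l : ℕ} (h : t ≤ l) (hl : l ≤ L) {D : Set (Idx n k l)} (hD : IsSaturated t D)
    {F : Idx n k l → Matrix (Fin 2 × Fin 2) (Fin 2 × Fin 2) ℂ} (hin : ∀ q ∈ D, F q = cnot)
    (hout : ∀ q, q ∉ D → F q = 1) : IsTransversalAt₂ B h (tensor₂ F) := by
  classical
  have := nonempty_idx Q hk t
  induction l, h using Nat.le_induction with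
  | base =>
    refine isTransversalAt₂_self fun q => ?_
    by_cases hq : q ∈ D
    · rw [hin q hq]; exact cnot_mem_unitaryGroup
    · rw [hout q hq]; exact one_mem _
  | succ l h ih =>
    let c : Fin L := ⟨l, hl⟩
    obtain ⟨e, φ, hφ, hE⟩ := (hB c).exists_cnot
    -- The sign vector `e` of code `c` is repeated on each full block; the other blocks need no
    -- correction.
    let ε : Idx n k (l + 1) → ZMod 2 := fun q =>
      if q ∈ D then e ((outerEquiv n k c).symm q).2 else 0
    let P : Idx n k (l + 1) → Matrix (Fin 2 × Fin 2) (Fin 2 × Fin 2) ℂ := fun q =>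
      (if ε q = 1 then sigmaZ else 1) ⊗ₖ (if ε q = 1 then sigmaX else 1)
    have hP : tensor₂ P = pauliZ ε ⊗ₖ pauliX ε := tensor₂_kronecker _ _
    let F₀ : Idx n k l → Matrix (Fin 2 × Fin 2) (Fin 2 × Fin 2) ℂ := fun q =>
      if q ∈ lowerSet c D then cnot else 1
    let φ₀ : Block n k c → ℂ := fun b => if ∃ j, outerEquiv n k c (b, j) ∈ D then φ else 1
    have hstep : tensor₂ F₀ * (stepEncoder B c ⊗ₖ stepEncoder B c) =
        (∏ b, φ₀ b) • ((stepEncoder B c ⊗ₖ stepEncoder B c) * tensor₂ fun q => F q * P q) := by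
      rw [stepEncoder_eq_blockEncoder]
      refine tensor₂_mul_blockEncoder _ _ fun b => ?_
      by_cases hb : ∃ j, outerEquiv n k c (b, j) ∈ D
      · have hD' : ∀ j, outerEquiv n k c (b, j) ∈ D :=
          fun j => hD.outerEquiv_mem h hb.choose_spec j
        have h1 : ∀ j, P (outerEquiv n k c (b, j)) =
            (if e j = 1 then sigmaZ else 1) ⊗ₖ (if e j = 1 then sigmaX else 1) := by
          intro j
          simp [P, ε, hD' j]
        have h2 : ∀ i, F₀ (innerEquiv n k c (b, i)) = cnot :=
          fun i => if_pos (innerEquiv_mem_lowerSet.mpr hb)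
        have h3 : φ₀ b = φ := if_pos hb
        simp only [h1, h2, h3, hin _ (hD' _)]
        rw [hE, ← tensor₂_mul, tensor₂_kronecker, pauliZ, pauliX]
      · have hD' : ∀ j, outerEquiv n k c (b, j) ∉ D := fun j hj => hb ⟨j, hj⟩
        have h1 : ∀ j, P (outerEquiv n k c (b, j)) = 1 := by
          intro j
          simp [P, ε, hD' j]
        have h2 : ∀ i, F₀ (innerEquiv n k c (b, i)) = 1 :=
          fun i => if_neg (mt innerEquiv_mem_lowerSet.mp hb)
        have h3 : φ₀ b = 1 := if_neg hb
        simp only [h1, h2, h3, hout _ (hD' _), Matrix.mul_one, Matrix.one_mul, tensor₂_one,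
          one_smul]
    have hφ₀ : ‖∏ b, φ₀ b‖ = 1 := by
      rw [norm_prod]
      refine Finset.prod_eq_one fun b _ => ?_
      simp only [φ₀]
      split_ifs <;> simp [hφ]
    have hF₀ : IsTransversalAt₂ B h (tensor₂ F₀) :=
      ih (Nat.le_of_succ_le hl) (D := lowerSet c D) hD.lowerSet (fun q hq => if_pos hq)
        fun q hq => if_neg hq
    have hFP := IsTransversalAt₂.of_step hl hφ₀ hstep hF₀
    have hPt : IsTransversalAt₂ B (h.trans l.le_succ) (tensor₂ P) := by
      rw [hP]
      exact (isTransversalAt_pauliZ hk _ hl ε).kronecker (isTransversalAt_pauliX hk _ hl ε)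
    -- The correction is an involution, so multiplying by it once more leaves the CNOT gates alone.
    have hPP : tensor₂ P * tensor₂ P = 1 := by
      rw [hP, ← mul_kronecker_mul, pauliZ_mul_self, pauliX_mul_self]
      exact kroneckerMap_one_one _ (by simp) (by simp) (by simp)
    have hfin := hFP.mul hPt
    rwa [← tensor₂_mul, Matrix.mul_assoc, hPP, Matrix.mul_one] at hfin

/-- The indices that may vary, from `t` to `l - 1`, are among those whose index set is everything,
because `m ≤ t`. -/
theorem isSaturated_indexSets {m t l : ℕ} (hmt : m ≤ t) (q : Idx n k l) :
    IsSaturated t {q' : Idx n k l | ∀ c, q' c ∈ indexSets m q c} := by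
  intro q₁ q₂ h h₁ c
  have h2 := h₁ c
  by_cases hc : m ≤ c.val ∧ c.val < l
  · simp [indexSets, hc]
  · rwa [← h c (by omega)]

end Levels

end Multilevel

/-! ### The three families of transversal gates -/

open Multilevel

theorem theorem3 {L : ℕ} {n k : Fin L → ℕ} (hk : ∀ c, 1 ≤ k c)
    (Q : ∀ c, Multilevel.SelfDualCSS (n c) (k c))
    (B : ∀ c, Multilevel.SymplecticBasis (Q c)) (hB : ∀ c, (B c).IsCompatible)
    (m l : ℕ) (hml : m < l) (hlL : l ≤ L) (q : Multilevel.Idx n k l)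
    (t : ℕ) (hmt : m ≤ t) (htl : t ≤ l) :
    Multilevel.IsTransversalAt B htl (Multilevel.gateH (Multilevel.indexSets m q)) ∧
    (∀ a : Multilevel.Idx n k l → ℤˣ,
      Multilevel.IsTransversalAt B htl (Multilevel.gateS (Multilevel.indexSets m q) a)) ∧
    Multilevel.IsTransversalAt₂ B htl (Multilevel.gateCNOT (Multilevel.indexSets m q)) := by
  have hD := isSaturated_indexSets hmt q
  refine ⟨?_, fun a => ?_, ?_⟩
  · refine isTransversalAt_tensor hk (𝒮 := {hadamard}) ?_ ?_ htl hlL hD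
      (fun q' hq' => if_pos hq') fun q' hq' => if_neg hq'
    · rintro g rfl
      exact hadamard_mem_unitaryGroup
    · intro c G' hG'
      obtain rfl : G' = fun _ => hadamard := funext hG'
      exact ⟨fun _ => hadamard, fun _ => rfl, (hB c).hadamard⟩
  -- Compatibility is needed here for every sign pattern: the signs `b` obtained on the qubits at
  -- one level are uncontrolled, and they become the prescribed signs for the next code below.
  · refine isTransversalAt_tensor hk (𝒮 := Set.range phasePow) ?_ ?_ htl hlL hD
      (fun q' hq' => ⟨a q', (if_pos hq').symm⟩) fun q' hq' => if_neg hq'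
    · rintro _ ⟨b, rfl⟩
      exact phasePow_mem_unitaryGroup b
    · intro c G' hG'
      choose a' ha' using hG'
      obtain rfl : (fun j => phasePow (a' j)) = G' := funext ha'
      obtain ⟨b, hb⟩ := (hB c).phase a'
      exact ⟨fun i => phasePow (b i), fun i => ⟨b i, rfl⟩, hb⟩
  · exact isTransversalAt₂_cnot hk hB htl hlL hD (fun q' hq' => if_pos hq')
      fun q' hq' => if_neg hq'
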